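/- Fix the following conventions. A randomized protocol on finite input sets $\mathcal X,\mathcal Y$ is a finite rooted binary tree in which every inner vertex belongs to Alice or to Bob, together with mutually independent finite-valued random variables $R$ (public coins), $R_A$ and $R_B$ (private coins of Alice and of Bob), which are independent of the inputs $(X,Y)$. At a vertex of Alice the bit sent is a function of $(x,R,R_A)$, at a vertex of Bob a function of $(y,R,R_B)$, and at a leaf Bob's output is a function of $(y,R,R_B)$. The transcript $\Pi$ is the sequence of bits sent, that is, the path to the leaf reached. The protocol is public-coin if none of these functions depends on $R_A,R_B$, and one-round if all inner vertices belong to Alice (she sends one message $\Pi$, then Bob outputs). For inputs $(X,Y)$ distributed according to $\mu$, the expected length is the expected depth of the leaf reached, over $\mu$ and all coins, and the information complexity is $IC_\mu(\pi)=I(X:\Pi\mid Y,R)+I(Y:\Pi\mid X,R)$, in bits (for a one-round protocol the second term is $0$). The statistical distance of two random variables $A,B$ with values in a set $V$ is $\delta(A,B)=\max_{U\subseteq V}|\Pr[A\in U]-\Pr[B\in U]|$. **Theorem.** There are absolute constants $C_1\ge 1$ and $C_2>0$ such that the following holds. Let $\pi$ be a one-round protocol on finite input sets $\mathcal X,\mathcal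 Y$, possibly with public and private coins, let $\mu$ be a probability distribution on $\mathcal X\times\mathcal Y$, let $I=IC_\mu(\pi)$ and let $0<\varepsilon\le 1$. Then there is a public-coin (possibly many-round) protocol $\tau$ on $\mathcal X,\mathcal Y$ whose expected length, with respect to $\mu$ and the coins of $\tau$, is at most $$I+\log_2(I+C_1)+2\sqrt{I+\log_2(I+C_1)}+C_2\log_2\frac1\varepsilon,$$ and such that for every pair of inputs $(x,y)\in\mathcal X\times\mathcal Y$ Bob's output $\Pi'$ in $\tau$ satisfies $$\delta\big((\Pi\mid X=x,Y=y),\,(\Pi'\mid X=x,Y=y)\big)\le\varepsilon,$$ where both distributions are those of the protocols run on the fixed inputs $x,y$. -/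

import Mathlib

/-! Finite probability spaces: a distribution on a finite type `Ω` is an element of
`stdSimplex ℝ Ω`; a random variable is a function on `Ω`. -/

noncomputable section

open scoped Classical in
/-- Probability of the event `E`. -/
def prob {Ω : Type*} [Fintype Ω] (p : stdSimplex ℝ Ω) (E : Set Ω) : ℝ :=
  ∑ ω, if ω ∈ E then p ω else 0

/-- The product distribution (independent coupling). -/
def prodDist {A B : Type*} [Fintype A] [Fintype B] (p : stdSimplex ℝ A) (q : stdSimplex ℝ B) :
    stdSimplex ℝ (A × B) :=
  ⟨fun ab => p ab.1 * q ab.2,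
    fun ab => mul_nonneg (p.2.1 ab.1) (q.2.1 ab.2), by
      rw [Fintype.sum_prod_type, ← Fintype.sum_mul_sum]
      exact (congrArg₂ (· * ·) p.2.2 q.2.2).trans (one_mul 1)⟩

/-- Expectation of a real random variable. -/
def expect {Ω : Type*} [Fintype Ω] (p : stdSimplex ℝ Ω) (f : Ω → ℝ) : ℝ :=
  ∑ ω, p ω * f ω

/-- `Pr[E | F]`; only used multiplied by `Pr[F]`, so its value for `Pr[F] = 0` is irrelevant. -/
def condProb {Ω : Type*} [Fintype Ω] (p : stdSimplex ℝ Ω) (E F : Set Ω) : ℝ :=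
  prob p (E ∩ F) / prob p F

open scoped Classical in
/-- The entropy (in bits) of `A` conditioned on the event `F`. -/
def entropyGiven {Ω V : Type*} [Fintype Ω] (p : stdSimplex ℝ Ω) (A : Ω → V) (F : Set Ω) : ℝ :=
  ∑ a ∈ Finset.univ.image A,
    condProb p (A ⁻¹' {a}) F * Real.logb 2 (1 / condProb p (A ⁻¹' {a}) F)

open scoped Classical in
/-- Conditional Shannon entropy `H(A | B) = ∑ b, Pr[B = b] * H(A | B = b)`, in bits. -/
def condEntropy {Ω V W : Type*} [Fintype Ω] (p : stdSimplex ℝ Ω) (A : Ω → V) (B : Ω → W) : ℝ :=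
  ∑ b ∈ Finset.univ.image B, prob p (B ⁻¹' {b}) * entropyGiven p A (B ⁻¹' {b})

/-- Conditional mutual information `I(A : B | C) = H(A | C) - H(A | B, C)`, in bits. -/
def condMutualInfo {Ω U V W : Type*} [Fintype Ω] (p : stdSimplex ℝ Ω)
    (A : Ω → U) (B : Ω → V) (C : Ω → W) : ℝ :=
  condEntropy p A C - condEntropy p A (fun ω => (B ω, C ω))

/-- Statistical distance between two `V`-valued random variables, which may live on different
finite probability spaces: the supremum of `|Pr[A ∈ U] - Pr[B ∈ U]|` over all `U ⊆ V`. -/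
def statDist {Ω Ω' V : Type*} [Fintype Ω] [Fintype Ω'] (p : stdSimplex ℝ Ω) (A : Ω → V)
    (q : stdSimplex ℝ Ω') (B : Ω' → V) : ℝ :=
  ⨆ U : Set V, |prob p (A ⁻¹' U) - prob q (B ⁻¹' U)|

/-- Protocol trees: finite rooted binary trees whose inner vertices belong to Alice or to Bob and
whose leaves carry Bob's output. Alice sees her input in `X`, the public coins in `R` and her
private coins in `RA`; Bob sees his input in `Y`, the public coins and his private coins in `RB`.
The two subtrees of an inner vertex are indexed by the bit that is sent there. -/
inductive ProtocolTree (X Y R RA RB O : Type*)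
  | leaf (φ : Y → R → RB → O) : ProtocolTree X Y R RA RB O
  | alice (f : X → R → RA → Bool) (child : Bool → ProtocolTree X Y R RA RB O) :
      ProtocolTree X Y R RA RB O
  | bob (g : Y → R → RB → Bool) (child : Bool → ProtocolTree X Y R RA RB O) :
      ProtocolTree X Y R RA RB O

namespace ProtocolTree

variable {X Y R RA RB O : Type*}

/-- The sequence of all bits sent; its length is the depth of the leaf that is reached. -/
def transcript : ProtocolTree X Y R RA RB O → X → Y → R → RA → RB → List Bool
  | leaf _, _, _, _, _, _ => []
  | alice f child, x, y, r, ra, rb =>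
      f x r ra :: (child (f x r ra)).transcript x y r ra rb
  | bob g child, x, y, r, ra, rb =>
      g y r rb :: (child (g y r rb)).transcript x y r ra rb

/-- Bob's output at the leaf that is reached. -/
def output : ProtocolTree X Y R RA RB O → X → Y → R → RA → RB → O
  | leaf φ, _, y, r, _, rb => φ y r rb
  | alice f child, x, y, r, ra, rb => (child (f x r ra)).output x y r ra rb
  | bob g child, x, y, r, ra, rb => (child (g y r rb)).output x y r ra rb

/-- No function in the tree depends on private coins. -/
def IsPublicCoin : ProtocolTree X Y R RA RB O → Prop
  | leaf φ => ∀ y r rb rb', φ y r rb = φ y r rb'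
  | alice f child => (∀ x r ra ra', f x r ra = f x r ra') ∧ ∀ b, (child b).IsPublicCoin
  | bob g child => (∀ y r rb rb', g y r rb = g y r rb') ∧ ∀ b, (child b).IsPublicCoin

/-- Only Alice speaks: she sends one message, after which Bob produces his output. -/
def IsOneRound : ProtocolTree X Y R RA RB O → Prop
  | leaf _ => True
  | alice _ child => ∀ b, (child b).IsOneRound
  | bob _ _ => False

end ProtocolTree

/-- A randomized protocol: a protocol tree together with the (finite) distributions of the public
coins and of the private coins of Alice and Bob. -/
structure RandomizedProtocol.{u, v, w, z} (X : Type u) (Y : Type v) (O : Type z) where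
  R : Type w
  RA : Type w
  RB : Type w
  fintypeR : Fintype R
  fintypeRA : Fintype RA
  fintypeRB : Fintype RB
  distR : stdSimplex ℝ R
  distRA : stdSimplex ℝ RA
  distRB : stdSimplex ℝ RB
  tree : ProtocolTree X Y R RA RB O

attribute [instance] RandomizedProtocol.fintypeR RandomizedProtocol.fintypeRA
  RandomizedProtocol.fintypeRB

namespace RandomizedProtocol

variable {X Y O : Type*} (π : RandomizedProtocol X Y O)

def IsPublicCoin : Prop := π.tree.IsPublicCoin

def IsOneRound : Prop := π.tree.IsOneRound

/-- The coins `(r, r_A, r_B)`. -/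
abbrev Coins : Type _ := π.R × π.RA × π.RB

/-- The three kinds of coins are mutually independent. -/
def coinDist : stdSimplex ℝ π.Coins :=
  prodDist π.distR (prodDist π.distRA π.distRB)

/-- The transcript on inputs `x`, `y`, a random variable on the space of coins. -/
def transcript (x : X) (y : Y) (c : π.Coins) : List Bool :=
  π.tree.transcript x y c.1 c.2.1 c.2.2

/-- Bob's output on inputs `x`, `y`, a random variable on the space of coins. -/
def output (x : X) (y : Y) (c : π.Coins) : O :=
  π.tree.output x y c.1 c.2.1 c.2.2

variable [Fintype X] [Fintype Y]

/-- Joint distribution of inputs and coins: the inputs are independent of the coins. -/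
def jointDist (μ : stdSimplex ℝ (X × Y)) : stdSimplex ℝ ((X × Y) × π.Coins) :=
  prodDist μ π.coinDist

/-- Expected number of bits sent, over inputs drawn from `μ` and over the coins. -/
def expectedLength (μ : stdSimplex ℝ (X × Y)) : ℝ :=
  expect (π.jointDist μ) fun ω => ((π.transcript ω.1.1 ω.1.2 ω.2).length : ℝ)

/-- Information complexity `I(X : Π | Y, R) + I(Y : Π | X, R)`. -/
def infoComplexity (μ : stdSimplex ℝ (X × Y)) : ℝ :=
  condMutualInfo (π.jointDist μ) (fun ω => ω.1.1)
      (fun ω => π.transcript ω.1.1 ω.1.2 ω.2) (fun ω => (ω.1.2, ω.2.1)) +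
    condMutualInfo (π.jointDist μ) (fun ω => ω.1.2)
      (fun ω => π.transcript ω.1.1 ω.1.2 ω.2) (fun ω => (ω.1.1, ω.2.1))

end RandomizedProtocol

end

/-!
Fix the public coins `r`. Let `P` be the distribution of Alice's message given her input `x`, and
`Q` the distribution that Bob, who knows only `y`, expects for it. The information complexity of a
one-round protocol is the average of `log₂ (P v / Q v)` over all inputs, coins and messages `v`
(`infoComplexity_eq`), so it is enough to communicate a sample `v ∼ P` with about
`log₂ (P v / Q v)` bits.

The public coins contain `N` uniform points `(vᵢ, uᵢ)` under the graph of the constant `1`. Alice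
selects the first one below the graph of `P`; its `vᵢ` has distribution `P`, unless no point is
below the graph (`prob_exists_isFirstIn`). She then reveals random hash bits of the index `i`. After
`b` bits Bob lists the points below the graph of `t * Q`, where `t` is slightly less than `2 ^ b`,
and announces whether one of them has the hash bits he has seen; if so, he outputs its value, and
otherwise Alice goes on. Alice's point is on the list once `P v ≤ t * Q v`, and the union bound over
the list shows that another point rarely has the same bits (`prob_collision_le`).

In the stage `j`, after about `j ^ 2` bits, `t` is `2 ^ b / (j + 1) ^ 2` up to a constant. The
divisor makes the error probabilities of the stages summable, and it raises the number of bits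
required at log-likelihood ratio `l` from `l` to `n = l + log₂ (l + 4) + 2`, up to a surplus of
`O(log (1 / ε))` (`need`, `rpow_le_of_need_le`). Reaching `n` bits takes `√n` stages, each with one
bit of Bob. Alice may overshoot by up to the block length `2 √n`; shifting the squares to
`(j + θ / K) ^ 2` and averaging over the phase `θ` reduces this to `√n` (`sum_sched_stageFor_le`),
and some fixed phase is at least as good as the average. This gives `n + 2 √n + O(log (1 / ε))` bits
for a message with log-likelihood ratio `l` (`exists_protocol_of_kernel`), and the bound on the
expectation follows from the concavity of the logarithm and of the square root (`expect_need_le`).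

Two technical points. Bob uses the average of `Q` and the uniform distribution (`smoothBayes`), so
that the ratios are bounded also on inputs that have probability zero, where the output must be
correct as well. And since `log₂ (1 / ε)` vanishes at `ε = 1`, for `ε ≥ 1 / 2` additive constants
need another source: with probability `1 / 4` the message is replaced by a uniform one that is
independent of the inputs and costs `O(1)` bits, which saves a fourth of the information
(`exists_compression`, `length_bound_of_skip`).
-/

noncomputable section

open scoped Classical

/-! ### Finite probability -/

section Prob

variable {Ω Ω' A B : Type*} [Fintype Ω] [Fintype Ω'] [Fintype A] [Fintype B]

theorem prob_nonneg (p : stdSimplex ℝ Ω) (E : Set Ω) : 0 ≤ prob p E :=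
  Finset.sum_nonneg fun ω _ => by split_ifs; exacts [p.2.1 ω, le_rfl]

theorem prob_mono (p : stdSimplex ℝ Ω) {E F : Set Ω} (h : E ⊆ F) : prob p E ≤ prob p F :=
  Finset.sum_le_sum fun ω _ => by
    by_cases hE : ω ∈ E
    · simp [hE, h hE]
    · rw [if_neg hE]; split_ifs; exacts [p.2.1 ω, le_rfl]

theorem le_prob_of_mem (p : stdSimplex ℝ Ω) {E : Set Ω} {ω : Ω} (h : ω ∈ E) : p ω ≤ prob p E := by
  refine le_of_eq_of_le (if_pos h).symm
    (Finset.single_le_sum (f := fun ω => if ω ∈ E then p ω else 0) (fun ω _ => ?_)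
      (Finset.mem_univ ω))
  split_ifs
  exacts [p.2.1 ω, le_rfl]

theorem prob_univ (p : stdSimplex ℝ Ω) : prob p Set.univ = 1 := by
  simp [prob]

theorem nonempty_of_dist (p : stdSimplex ℝ Ω) : Nonempty Ω := by
  by_contra h
  rw [not_nonempty_iff] at h
  simpa using p.2.2

theorem prob_compl (p : stdSimplex ℝ Ω) (E : Set Ω) : prob p Eᶜ = 1 - prob p E := by
  rw [eq_sub_iff_add_eq, ← prob_univ p, prob, prob, prob, ← Finset.sum_add_distrib]
  refine Finset.sum_congr rfl fun ω _ => ?_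
  by_cases h : ω ∈ E <;> simp [h]

theorem prob_le_one (p : stdSimplex ℝ Ω) (E : Set Ω) : prob p E ≤ 1 :=
  (prob_mono p (Set.subset_univ E)).trans_eq (prob_univ p)

theorem prob_inter_compl (p : stdSimplex ℝ Ω) (E F : Set Ω) :
    prob p E - prob p F ≤ prob p (E ∩ Fᶜ) := by
  rw [sub_le_iff_le_add, prob, prob, prob, ← Finset.sum_add_distrib]
  refine Finset.sum_le_sum fun ω _ => ?_
  by_cases h : ω ∈ E <;> by_cases h' : ω ∈ F <;> simp [h, h']

theorem prob_biUnion_le {ι : Type*} (p : stdSimplex ℝ Ω) (s : Finset ι) (E : ι → Set Ω) :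
    prob p {ω | ∃ i ∈ s, ω ∈ E i} ≤ ∑ i ∈ s, prob p (E i) := by
  simp only [prob]
  rw [Finset.sum_comm]
  refine Finset.sum_le_sum fun ω _ => ?_
  have h0 : ∀ i ∈ s, 0 ≤ if ω ∈ E i then p ω else 0 := fun i _ => by
    split_ifs; exacts [p.2.1 ω, le_rfl]
  split_ifs with h
  · obtain ⟨i, hi, h⟩ := h
    refine le_trans ?_ (Finset.single_le_sum h0 hi)
    rw [if_pos h]
  · exact Finset.sum_nonneg h0

theorem prob_biUnion_eq {ι : Type*} (p : stdSimplex ℝ Ω) (s : Finset ι) (E : ι → Set Ω)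
    (hd : ∀ ω, ∀ i ∈ s, ∀ j ∈ s, ω ∈ E i → ω ∈ E j → i = j) :
    prob p {ω | ∃ i ∈ s, ω ∈ E i} = ∑ i ∈ s, prob p (E i) := by
  simp only [prob, Set.mem_ofPred_eq]
  rw [Finset.sum_comm]
  refine Finset.sum_congr rfl fun ω _ => ?_
  by_cases h : ∃ i ∈ s, ω ∈ E i
  · rw [if_pos h]
    obtain ⟨i, hi, h⟩ := h
    rw [Finset.sum_eq_single_of_mem i hi, if_pos h]
    intro j hj hji
    exact if_neg fun hj' => hji (hd ω j hj i hi hj' h)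
  · rw [if_neg h]
    refine (Finset.sum_eq_zero fun i hi => if_neg fun h' => h ⟨i, hi, h'⟩).symm

theorem prob_prodDist (p : stdSimplex ℝ A) (q : stdSimplex ℝ B) (E : Set (A × B)) :
    prob (prodDist p q) E = ∑ a, p a * prob q {b | (a, b) ∈ E} := by
  simp only [prob]
  rw [Fintype.sum_prod_type]
  refine Finset.sum_congr rfl fun a _ => ?_
  rw [Finset.mul_sum]
  refine Finset.sum_congr rfl fun b _ => ?_
  simp only [Set.mem_ofPred_eq, mul_ite, mul_zero]
  rfl

theorem expect_prodDist (p : stdSimplex ℝ A) (q : stdSimplex ℝ B) (f : A × B → ℝ) :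
    expect (prodDist p q) f = ∑ a, p a * expect q fun b => f (a, b) := by
  simp only [expect]
  rw [Fintype.sum_prod_type]
  refine Finset.sum_congr rfl fun a _ => ?_
  rw [Finset.mul_sum]
  exact Finset.sum_congr rfl fun b _ => mul_assoc _ _ _

theorem expect_mono (p : stdSimplex ℝ Ω) {f g : Ω → ℝ} (h : ∀ ω, f ω ≤ g ω) :
    expect p f ≤ expect p g :=
  Finset.sum_le_sum fun ω _ => mul_le_mul_of_nonneg_left (h ω) (p.2.1 ω)

theorem expect_const (p : stdSimplex ℝ Ω) (c : ℝ) : expect p (fun _ => c) = c := by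
  rw [expect, ← Finset.sum_mul]
  exact (congrArg (· * c) p.2.2).trans (one_mul c)

theorem expect_add (p : stdSimplex ℝ Ω) (f g : Ω → ℝ) :
    expect p (fun ω => f ω + g ω) = expect p f + expect p g := by
  simp only [expect, mul_add, Finset.sum_add_distrib]

theorem expect_add_const (p : stdSimplex ℝ Ω) (f : Ω → ℝ) (c : ℝ) :
    expect p (fun ω => f ω + c) = expect p f + c :=
  (expect_add p f fun _ => c).trans (congrArg _ (expect_const p c))

theorem expect_const_mul (p : stdSimplex ℝ Ω) (c : ℝ) (f : Ω → ℝ) :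
    expect p (fun ω => c * f ω) = c * expect p f := by
  simp only [expect, Finset.mul_sum]
  exact Finset.sum_congr rfl fun ω _ => mul_left_comm _ _ _

theorem expect_prodDist_fst (p : stdSimplex ℝ A) (q : stdSimplex ℝ B) (f : A → ℝ) :
    expect (prodDist p q) (fun c => f c.1) = expect p f := by
  rw [expect_prodDist]
  exact Finset.sum_congr rfl fun a _ => congrArg (p a * ·) (expect_const q (f a))

theorem prob_prodDist_fst (p : stdSimplex ℝ A) (q : stdSimplex ℝ B) (E : Set A) :
    prob (prodDist p q) {c | c.1 ∈ E} = prob p E := by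
  have h := expect_prodDist_fst p q fun a => if a ∈ E then 1 else 0
  simp only [expect, mul_ite, mul_one, mul_zero] at h
  exact h

theorem expect_one_add_sum {V : Type*} [Fintype V] (p : stdSimplex ℝ Ω) (E : V → Set Ω)
    [∀ v, DecidablePred (· ∈ E v)] (f : V → ℝ) :
    expect p (fun ω => 1 + ∑ v, if ω ∈ E v then f v else 0) = 1 + ∑ v, prob p (E v) * f v := by
  simp only [expect, mul_add, mul_one, Finset.sum_add_distrib, Finset.mul_sum]
  congr 1
  · exact p.2.2
  · rw [Finset.sum_comm]
    refine Finset.sum_congr rfl fun v _ => ?_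
    rw [prob, Finset.sum_mul]
    exact Finset.sum_congr rfl fun ω _ => by split_ifs <;> simp

theorem expect_comp {V : Type*} [Fintype V] (p : stdSimplex ℝ Ω) (M : Ω → V) (F : V → ℝ) :
    expect p (fun ω => F (M ω)) = ∑ v, prob p (M ⁻¹' {v}) * F v := by
  simp only [expect, prob, Finset.sum_mul]
  rw [Finset.sum_comm]
  refine Finset.sum_congr rfl fun ω _ => ?_
  rw [Finset.sum_eq_single_of_mem (M ω) (Finset.mem_univ _)]
  · simp
  · intro v _ hv
    simp [Ne.symm hv]

/-- It suffices to bound the loss of probability of each event: the other inequality follows by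
passing to the complementary event. -/
theorem statDist_le {V : Type*} (p : stdSimplex ℝ Ω) (X : Ω → V) (q : stdSimplex ℝ Ω')
    (Y : Ω' → V) (ε : ℝ) (h : ∀ U : Set V, prob p (X ⁻¹' U) - ε ≤ prob q (Y ⁻¹' U)) :
    statDist p X q Y ≤ ε := by
  refine ciSup_le fun U => abs_le.2 ?_
  have h1 := h U
  have h2 := h Uᶜ
  rw [Set.preimage_compl, Set.preimage_compl, prob_compl, prob_compl] at h2
  constructor <;> linarith

/-- The product of a finite family of distributions. -/
def piDist {ι : Type*} [Fintype ι] [DecidableEq ι] (p : ι → stdSimplex ℝ Ω) : stdSimplex ℝ (ι → Ω) :=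
  ⟨fun ω => ∏ i, p i (ω i), fun ω => Finset.prod_nonneg fun i _ => (p i).2.1 _, by
    have h := Finset.prod_univ_sum (fun _ : ι => (Finset.univ : Finset Ω)) fun i a => p i a
    rw [Fintype.piFinset_univ] at h
    rw [← h]
    exact Finset.prod_eq_one fun i _ => (p i).2.2⟩

theorem prob_piDist {ι : Type*} [Fintype ι] [DecidableEq ι] (p : ι → stdSimplex ℝ Ω) (E : ι → Set Ω) :
    prob (piDist p) {ω | ∀ i, ω i ∈ E i} = ∏ i, prob (p i) (E i) := by
  simp only [prob, Set.mem_ofPred_eq]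
  rw [Finset.prod_univ_sum, Fintype.piFinset_univ]
  refine Finset.sum_congr rfl fun ω _ => ?_
  by_cases h : ∀ i, ω i ∈ E i
  · rw [if_pos h]
    exact Finset.prod_congr rfl fun i _ => (if_pos (h i)).symm
  · rw [if_neg h]
    obtain ⟨i, hi⟩ := not_forall.1 h
    exact (Finset.prod_eq_zero (Finset.mem_univ i) (if_neg hi)).symm

/-- The uniform distribution. -/
def unifDist (Ω : Type*) [Fintype Ω] [Nonempty Ω] : stdSimplex ℝ Ω :=
  ⟨fun _ => (Fintype.card Ω : ℝ)⁻¹, fun _ => by positivity, by simp⟩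

/-- The image of a distribution on `A` under a bijection `A ≃ B`. -/
def equivDist (e : A ≃ B) (p : stdSimplex ℝ A) : stdSimplex ℝ B :=
  ⟨fun b => p (e.symm b), fun _ => p.2.1 _, (Equiv.sum_comp e.symm fun a => p a).trans p.2.2⟩

end Prob

/-! ### Thresholds -/

/-- Finitely many reals `c ∈ S` can be realized simultaneously as the masses `∑ s ≤ c, w s` of
initial segments of `S`: take the gaps between consecutive elements as weights. -/
theorem exists_threshold_weights (S : Finset ℝ) (hS : ∀ s ∈ S, 0 ≤ s) :
    ∃ w : ℝ → ℝ, (∀ s ∈ S, 0 ≤ w s) ∧ ∀ c ∈ S, ∑ s ∈ S with s ≤ c, w s = c := by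
  induction S using Finset.induction_on_max with
  | empty => exact ⟨0, by simp, by simp⟩
  | insert a S ha ih =>
    obtain ⟨w, hw, hwS⟩ := ih fun s hs => hS s (Finset.mem_insert_of_mem hs)
    have haS : a ∉ S := fun h => lt_irrefl _ (ha a h)
    have htot : ∑ s ∈ S, w s ≤ a := by
      rcases S.eq_empty_or_nonempty with rfl | hne
      · simpa using hS a (by simp)
      · have h := hwS _ (S.max'_mem hne)
        rw [Finset.filter_true_of_mem fun s hs => S.le_max' s hs] at h
        rw [h]
        exact (ha _ (S.max'_mem hne)).le
    have hup : ∀ T : Finset ℝ, T ⊆ S →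
        ∑ s ∈ T, Function.update w a (a - ∑ s ∈ S, w s) s = ∑ s ∈ T, w s := fun T hT =>
      Finset.sum_congr rfl fun s hs =>
        Function.update_of_ne (ne_of_mem_of_not_mem (hT hs) haS) _ _
    refine ⟨Function.update w a (a - ∑ s ∈ S, w s), fun s hs => ?_, fun c hc => ?_⟩
    · rcases Finset.mem_insert.1 hs with rfl | hs
      · simpa using htot
      · rw [Function.update_of_ne (ne_of_mem_of_not_mem hs haS)]
        exact hw s hs
    · rcases Finset.mem_insert.1 hc with rfl | hc
      · rw [Finset.filter_true_of_mem, Finset.sum_insert haS, hup S subset_rfl,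
          Function.update_self]
        · ring
        · intro s hs
          rcases Finset.mem_insert.1 hs with rfl | hs
          exacts [le_rfl, (ha s hs).le]
      · rw [Finset.filter_insert, if_neg (not_le.2 (ha c hc)), hup _ (Finset.filter_subset _ _)]
        exact hwS c hc

/-- A finite stand-in for a uniform point `(val, lev)` of `V × [0, 1]`, which is exact for the
finitely many levels in `F`. -/
theorem exists_uniform_levels (V : Type) [Fintype V] [Nonempty V] (F : Finset ℝ)
    (hF0 : ∀ c ∈ F, 0 ≤ c) (hF1 : ∀ c ∈ F, c ≤ 1) :
    ∃ (W : Type) (_ : Fintype W) (p : stdSimplex ℝ W) (val : W → V) (lev : W → ℝ),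
      ∀ c ∈ F, ∀ v, prob p {w | val w = v ∧ lev w ≤ c} = c / Fintype.card V := by
  obtain ⟨w, hw, hwS⟩ := exists_threshold_weights (insert 1 F) (by simpa using hF0)
  have hsum : ∀ c ∈ insert 1 F,
      (∑ s : {s // s ∈ insert (1 : ℝ) F}, if (s : ℝ) ≤ c then w s else 0) = c := by
    intro c hc
    rw [Finset.sum_coe_sort (insert 1 F) fun s => if s ≤ c then w s else 0,
      ← Finset.sum_filter]
    exact hwS c hc
  have h1 : ∑ s : {s // s ∈ insert (1 : ℝ) F}, w s = 1 := by
    refine Eq.trans ?_ (hsum 1 (by simp))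
    refine Finset.sum_congr rfl fun s _ => (if_pos ?_).symm
    rcases Finset.mem_insert.1 s.2 with h | h
    exacts [h.le, hF1 _ h]
  let q : stdSimplex ℝ {s // s ∈ insert (1 : ℝ) F} := ⟨fun s => w s, fun s => hw s s.2, h1⟩
  refine ⟨V × {s // s ∈ insert (1 : ℝ) F}, inferInstance, prodDist (unifDist V) q, Prod.fst,
    fun a => a.2, fun c hc v => ?_⟩
  rw [prob_prodDist, Finset.sum_eq_single_of_mem v (Finset.mem_univ v)]
  · have : prob q {b | (v, b) ∈ {a : V × {s // s ∈ insert (1 : ℝ) F} |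
        a.1 = v ∧ (a.2 : ℝ) ≤ c}} = c := by
      refine Eq.trans ?_ (hsum c (Finset.mem_insert_of_mem hc))
      exact Finset.sum_congr rfl fun s _ => by simp; rfl
    rw [this, div_eq_inv_mul]
    rfl
  · intro v' _ hv
    have : {b | (v', b) ∈ {a : V × {s // s ∈ insert (1 : ℝ) F} |
        a.1 = v ∧ (a.2 : ℝ) ≤ c}} = ∅ := by
      ext b; simp [hv]
    rw [this]
    simp [prob]

/-! ### Rejection sampling -/

/-- `i` is the first of the trials `ω` that falls into `A`. -/
def IsFirstIn {W : Type*} {N : ℕ} (A : Set W) (ω : Fin N → W) (i : Fin N) : Prop :=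
  ω i ∈ A ∧ ∀ j < i, ω j ∉ A

theorem IsFirstIn.unique {W : Type*} {N : ℕ} {A : Set W} {ω : Fin N → W} {i j : Fin N}
    (hi : IsFirstIn A ω i) (hj : IsFirstIn A ω j) : i = j := by
  rcases lt_trichotomy i j with h | h | h
  exacts [absurd hi.1 (hj.2 i h), h, absurd hj.1 (hi.2 j h)]

theorem prob_isFirstIn {W : Type*} [Fintype W] {N : ℕ} (p : stdSimplex ℝ W) (A B : Set W)
    (i : Fin N) :
    prob (piDist fun _ => p) {ω | IsFirstIn A ω i ∧ ω i ∈ B} =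
      (1 - prob p A) ^ (i : ℕ) * prob p (A ∩ B) := by
  have hset : {ω : Fin N → W | IsFirstIn A ω i ∧ ω i ∈ B} =
      {ω | ∀ j, ω j ∈ if j < i then Aᶜ else if j = i then A ∩ B else Set.univ} := by
    ext ω
    constructor
    · rintro ⟨⟨h1, h2⟩, h3⟩ j
      split_ifs with hj hj'
      · exact h2 j hj
      · subst hj'
        exact ⟨h1, h3⟩
      · trivial
    · intro h
      have hi := h i
      rw [if_neg (lt_irrefl i), if_pos rfl] at hi
      refine ⟨⟨hi.1, fun j hj => ?_⟩, hi.2⟩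
      have := h j
      rwa [if_pos hj] at this
  have hprob : ∀ j, prob p (if j < i then Aᶜ else if j = i then A ∩ B else Set.univ) =
      if j < i then 1 - prob p A else if j = i then prob p (A ∩ B) else 1 := by
    intro j
    split_ifs
    exacts [prob_compl p A, rfl, prob_univ p]
  rw [hset, prob_piDist, Finset.prod_congr rfl fun j _ => hprob j, Finset.prod_ite,
    Finset.prod_const]
  congr 1
  · congr 1
    rw [← Fin.card_Iio i]
    congr 1
    ext j
    simp
  · rw [Finset.prod_ite_eq_of_mem' _ _ _ (by simp)]

/-- The first accepted trial has the conditional distribution given acceptance, up to the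
probability that all trials are rejected. -/
theorem prob_exists_isFirstIn {W : Type*} [Fintype W] (N : ℕ) (p : stdSimplex ℝ W) (A B : Set W) :
    prob p A * prob (piDist fun _ : Fin N => p) {ω | ∃ i, IsFirstIn A ω i ∧ ω i ∈ B} =
      prob p (A ∩ B) * (1 - (1 - prob p A) ^ N) := by
  have h := prob_biUnion_eq (piDist fun _ : Fin N => p) Finset.univ
    (fun i => {ω | IsFirstIn A ω i ∧ ω i ∈ B}) fun ω i _ j _ hi hj => hi.1.unique hj.1
  simp only [Finset.mem_univ, true_and, Set.mem_ofPred_eq] at h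
  rw [h, Finset.sum_congr rfl fun i _ => prob_isFirstIn p A B i, ← Finset.sum_mul,
    Fin.sum_univ_eq_sum_range fun i => (1 - prob p A) ^ i]
  have hg := mul_neg_geom_sum (1 - prob p A) N
  rw [sub_sub_cancel] at hg
  rw [← hg]
  ring

/-! ### Hashing -/

/-- The `k`-th hash bit of `i`, with the value `false` beyond the `B` bits available. -/
def hashBit {B N : ℕ} (h : Fin B → Fin N → Bool) (i : Fin N) (k : ℕ) : Bool :=
  if hk : k < B then h ⟨k, hk⟩ i else false

theorem prob_unif_eq_half {N : ℕ} {i j : Fin N} (hij : i ≠ j) :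
    prob (unifDist (Fin N → Bool)) {g | g i = g j} = 1 / 2 := by
  -- Flipping the value at `i` exchanges the event with its complement.
  have hflip : prob (unifDist (Fin N → Bool)) {g | g i = g j}ᶜ =
      prob (unifDist (Fin N → Bool)) {g | g i = g j} := by
    have hinv : Function.Involutive fun g : Fin N → Bool => Function.update g i (!g i) := by
      intro g
      simp
    simp only [prob]
    rw [← Equiv.sum_comp hinv.toPerm]
    refine Finset.sum_congr rfl fun g _ => ?_
    have : (Function.update g i (!g i)) ∈ {g : Fin N → Bool | g i = g j}ᶜ ↔
        g ∈ {g : Fin N → Bool | g i = g j} := by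
      simp [Function.update_of_ne hij.symm]
    simp only [Function.Involutive.coe_toPerm, this]
    by_cases hg : g i = g j <;> simp only [Set.mem_ofPred_eq, hg, if_true, if_false]
    rfl
  rw [prob_compl] at hflip
  linarith

theorem prob_hash_agree {B N b : ℕ} (hb : b ≤ B) {i j : Fin N} (hij : i ≠ j) :
    prob (piDist fun _ : Fin B => unifDist (Fin N → Bool))
      {h | ∀ k < b, hashBit h i k = hashBit h j k} = (1 / 2) ^ b := by
  have hset : {h : Fin B → Fin N → Bool | ∀ k < b, hashBit h i k = hashBit h j k} =
      {h | ∀ k : Fin B, h k ∈ if (k : ℕ) < b then {g | g i = g j} else Set.univ} := by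
    ext h
    constructor
    · intro H k
      split_ifs with hk
      · have := H k hk
        simpa [hashBit] using this
      · trivial
    · intro H k hk
      have := H ⟨k, hk.trans_le hb⟩
      rw [if_pos hk] at this
      simpa [hashBit, hk.trans_le hb] using this
  have hprob : ∀ k : Fin B, prob (unifDist (Fin N → Bool))
      (if (k : ℕ) < b then {g | g i = g j} else Set.univ) = if (k : ℕ) < b then 1 / 2 else 1 := by
    intro k
    split_ifs
    exacts [prob_unif_eq_half hij, prob_univ _]
  rw [hset, prob_piDist, Finset.prod_congr rfl fun k _ => hprob k, Finset.prod_ite,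
    Finset.prod_const, Finset.prod_const_one, mul_one]
  congr 1
  rw [Fin.card_filter_val_lt, min_eq_right hb]

/-! ### Guessing protocols -/

/-- The first `n` values of a sequence of bits. -/
def prefixBits (f : ℕ → Bool) (n : ℕ) : List Bool := (List.range n).map f

theorem prefixBits_succ (f : ℕ → Bool) (n : ℕ) : prefixBits f (n + 1) = prefixBits f n ++ [f n] := by
  simp [prefixBits, List.range_succ]

theorem length_prefixBits (f : ℕ → Bool) (n : ℕ) : (prefixBits f n).length = n := by
  simp [prefixBits]

namespace ProtocolTree

variable {X Y R O : Type*}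

/-- Alice sends the bits number `s, …, s + n - 1` of the sequence `α`; all bits she has sent,
appended to `acc`, are handed to the continuation. -/
def sendBits (α : X → R → ℕ → Bool) :
    ℕ → ℕ → List Bool → (List Bool → ProtocolTree X Y R Unit Unit O) →
      ProtocolTree X Y R Unit Unit O
  | 0, _, acc, cont => cont acc
  | n + 1, s, acc, cont =>
      alice (fun x r _ => α x r s) fun b => sendBits α n (s + 1) (acc ++ [b]) cont

/-- In stage `j` Alice extends the part of the bit sequence `α` that Bob knows to the length `b j`.
Bob then announces whether the guess `D` that he makes from it has succeeded; if so, he outputs the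
guess, otherwise they go on, for at most `J` stages. -/
def stages (α : X → R → ℕ → Bool) (D : ℕ → Y → R → List Bool → Option O) (o : O) (b : ℕ → ℕ) :
    ℕ → ℕ → ℕ → List Bool → ProtocolTree X Y R Unit Unit O
  | 0, _, _, _ => leaf fun _ _ _ => o
  | J + 1, j, s, acc =>
      sendBits α (b j - s) s acc fun acc' =>
        bob (fun y r _ => (D j y r acc').isSome) fun c =>
          if c then leaf fun y r _ => (D j y r acc').getD o
          else stages α D o b J (j + 1) (b j) acc'

/-- Alice tells whether `good` holds. If it does, the stages follow. -/
def guessing (good : X → R → Bool) (α : X → R → ℕ → Bool)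
    (D : ℕ → Y → R → List Bool → Option O) (o : O) (b : ℕ → ℕ) (J : ℕ) :
    ProtocolTree X Y R Unit Unit O :=
  alice (fun x r _ => good x r) fun c => if c then stages α D o b J 0 0 [] else leaf fun _ _ _ => o

variable (α : X → R → ℕ → Bool) (D : ℕ → Y → R → List Bool → Option O) (o : O) (b : ℕ → ℕ)
  (x : X) (y : Y) (r : R)

theorem output_sendBits (cont : List Bool → ProtocolTree X Y R Unit Unit O) (n s : ℕ) :
    (sendBits α n s (prefixBits (α x r) s) cont).output x y r () () =
      (cont (prefixBits (α x r) (s + n))).output x y r () () := by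
  induction n generalizing s with
  | zero => rfl
  | succ n ih =>
    rw [sendBits, output, ← prefixBits_succ, ih, Nat.add_right_comm, Nat.add_assoc]

theorem length_transcript_sendBits (cont : List Bool → ProtocolTree X Y R Unit Unit O) (n s : ℕ) :
    ((sendBits α n s (prefixBits (α x r) s) cont).transcript x y r () ()).length =
      n + ((cont (prefixBits (α x r) (s + n))).transcript x y r () ()).length := by
  induction n generalizing s with
  | zero => simp [sendBits]
  | succ n ih =>
    rw [sendBits, transcript, ← prefixBits_succ, List.length_cons, ih, Nat.add_right_comm s,
      Nat.add_assoc s]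
    omega

theorem isPublicCoin_sendBits (cont : List Bool → ProtocolTree X Y R Unit Unit O)
    (h : ∀ acc, (cont acc).IsPublicCoin) (n s : ℕ) (acc : List Bool) :
    (sendBits α n s acc cont).IsPublicCoin := by
  induction n generalizing s acc with
  | zero => exact h acc
  | succ n ih => exact ⟨fun _ _ _ _ => rfl, fun c => ih _ _⟩

theorem isPublicCoin_stages (J j s : ℕ) (acc : List Bool) :
    (stages α D o b J j s acc).IsPublicCoin := by
  induction J generalizing j s acc with
  | zero => exact fun _ _ _ _ => rfl
  | succ J ih =>
    refine isPublicCoin_sendBits α _ (fun acc => ?_) _ _ _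
    refine ⟨fun _ _ _ _ => rfl, fun c => ?_⟩
    cases c
    · exact ih _ _ _
    · exact fun _ _ _ _ => rfl

theorem isPublicCoin_guessing (good : X → R → Bool) (J : ℕ) :
    (guessing good α D o b J).IsPublicCoin := by
  refine ⟨fun _ _ _ _ => rfl, fun c => ?_⟩
  cases c
  · exact fun _ _ _ _ => rfl
  · exact isPublicCoin_stages _ _ _ _ _ _ _ _

variable {α D o b x y r}

theorem output_stages (hb : Monotone b) {v : O} (J j s : ℕ) (hs : s ≤ b j)
    (hD : ∀ i < j + J, ∀ w, D i y r (prefixBits (α x r) (b i)) = some w → w = v)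
    {i : ℕ} (hji : j ≤ i) (hi : i < j + J) (hsome : (D i y r (prefixBits (α x r) (b i))).isSome) :
    (stages α D o b J j s (prefixBits (α x r) s)).output x y r () () = v := by
  induction J generalizing j s with
  | zero => omega
  | succ J ih =>
    rw [stages, output_sendBits, Nat.add_sub_cancel' hs, output]
    rcases hd : D j y r (prefixBits (α x r) (b j)) with _ | w
    · rcases hji.eq_or_lt with rfl | hlt
      · simp [hd] at hsome
      · simp only [Option.isSome_none, Bool.false_eq_true, if_false]
        exact ih (j + 1) (b j) (hb j.le_succ) (fun i hi => hD i (by omega)) hlt (by omega)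
    · simp only [Option.isSome_some, if_true, output, hd, Option.getD_some]
      exact hD j (by omega) w hd

theorem length_transcript_stages_le (hb : Monotone b) (J j s : ℕ) (hs : s ≤ b j)
    {i : ℕ} (hji : j ≤ i) (hi : i < j + J) (hsome : (D i y r (prefixBits (α x r) (b i))).isSome) :
    ((stages α D o b J j s (prefixBits (α x r) s)).transcript x y r () ()).length + s + j ≤
      b i + i + 1 := by
  induction J generalizing j s with
  | zero => omega
  | succ J ih =>
    rw [stages, length_transcript_sendBits, Nat.add_sub_cancel' hs, transcript]
    have hbi := hb hji
    rcases hd : D j y r (prefixBits (α x r) (b j)) with _ | w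
    · rcases hji.eq_or_lt with rfl | hlt
      · simp [hd] at hsome
      · simp only [Option.isSome_none, Bool.false_eq_true, if_false, List.length_cons]
        have := ih (j + 1) (b j) (hb j.le_succ) hlt (by omega)
        omega
    · simp only [Option.isSome_some, if_true, transcript, List.length_cons, List.length_nil]
      omega

variable {good : X → R → Bool} {J : ℕ}

theorem output_guessing (hb : Monotone b) {v : O} (hg : good x r)
    (hD : ∀ i < J, ∀ w, D i y r (prefixBits (α x r) (b i)) = some w → w = v)
    {i : ℕ} (hi : i < J) (hsome : (D i y r (prefixBits (α x r) (b i))).isSome) :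
    (guessing good α D o b J).output x y r () () = v := by
  rw [guessing, output, hg]
  exact output_stages hb J 0 0 (Nat.zero_le _) (by simpa using hD) i.zero_le (by simpa using hi)
    hsome

theorem length_transcript_guessing_le (hb : Monotone b) (hg : good x r)
    {i : ℕ} (hi : i < J) (hsome : (D i y r (prefixBits (α x r) (b i))).isSome) :
    ((guessing good α D o b J).transcript x y r () ()).length ≤ b i + i + 2 := by
  rw [guessing, transcript, hg, List.length_cons]
  have := length_transcript_stages_le (o := o) hb J 0 0 (Nat.zero_le _) i.zero_le
    (by simpa using hi) hsome
  simp only [prefixBits, List.range_zero, List.map_nil] at this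
  simp only [if_true]
  omega

theorem length_transcript_guessing_of_not (hg : ¬ good x r) :
    ((guessing good α D o b J).transcript x y r () ()).length = 1 := by
  rw [guessing, transcript, Bool.eq_false_of_not_eq_true hg]
  rfl

end ProtocolTree

/-! ### The schedule of hash bits -/

/-- The number of hash bits, up to a fixed surplus, that Alice has sent after stage `j`: the square
`(j + θ / K) ^ 2`, rounded up. The phase `θ / K` takes equidistant values in `[0, 1)`. -/
def sched (K θ j : ℕ) : ℕ := ⌈(((j * K + θ : ℕ) : ℝ) / K) ^ 2⌉₊

theorem monotone_sched (K θ : ℕ) : Monotone (sched K θ) := by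
  intro i j hij
  unfold sched
  gcongr

theorem sq_le_sched {K : ℕ} (hK : 0 < K) (θ j : ℕ) : (j : ℝ) ^ 2 ≤ sched K θ j := by
  refine le_trans ?_ (Nat.le_ceil _)
  have hK' : (0 : ℝ) < K := Nat.cast_pos.2 hK
  gcongr
  rw [le_div_iff₀ hK']
  push_cast
  have : (0 : ℝ) ≤ θ := θ.cast_nonneg
  linarith

/-- The first stage `j` with `c ≤ j * K + θ`. -/
def stageOf (K c θ : ℕ) : ℕ := (c + K - 1 - θ) / K

theorem stageOf_mod {K c i : ℕ} (hK : 0 < K) (h1 : c ≤ i) (h2 : i < c + K) :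
    stageOf K c (i % K) = i / K := by
  have hi := Nat.div_add_mod i K
  have hlt := Nat.mod_lt i hK
  unfold stageOf
  generalize i / K = q at *
  generalize i % K = t at *
  subst hi
  refine Nat.div_eq_of_lt_le ?_ ?_
  · rw [mul_comm]; omega
  · rw [Nat.succ_mul, mul_comm]; omega

theorem sum_range_eq_sum_Ico_mod (K c : ℕ) (f : ℕ → ℝ) :
    ∑ θ ∈ Finset.range K, f θ = ∑ i ∈ Finset.Ico c (c + K), f (i % K) := by
  rw [← Nat.image_Ico_mod c K, Finset.sum_image]
  exact Nat.mod_injOn_Ico c K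

/-- The stage in which `n` hash bits have been sent, for the phase `θ`. -/
def stageFor (K : ℕ) (n : ℝ) (θ : ℕ) : ℕ := stageOf K ⌈K * √n⌉₊ θ

theorem stageFor_mul_add {K : ℕ} (hK : 0 < K) (n : ℝ) {θ : ℕ} (hθ : θ < K) :
    ⌈K * √n⌉₊ ≤ stageFor K n θ * K + θ := by
  unfold stageFor stageOf
  have h := Nat.div_add_mod (⌈K * √n⌉₊ + K - 1 - θ) K
  have hlt := Nat.mod_lt (⌈K * √n⌉₊ + K - 1 - θ) hK
  rw [mul_comm] at h
  omega

theorem le_sched_stageFor {K : ℕ} (hK : 0 < K) (n : ℝ) {θ : ℕ} (hθ : θ < K) :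
    n ≤ sched K θ (stageFor K n θ) := by
  refine le_trans ?_ (Nat.le_ceil _)
  have hK' : (0 : ℝ) < K := Nat.cast_pos.2 hK
  rw [← Real.sqrt_le_left (by positivity), le_div_iff₀ hK', mul_comm]
  exact (Nat.le_ceil _).trans (Nat.cast_le.2 (stageFor_mul_add hK n hθ))

theorem stageFor_le {K : ℕ} {n : ℝ} (hnK : n ≤ (K : ℝ) ^ 2) (θ : ℕ) :
    stageFor K n θ ≤ K ^ 2 + K := by
  have h1 : √n ≤ K := Real.sqrt_le_left (Nat.cast_nonneg K) |>.2 hnK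
  have h2 : ⌈K * √n⌉₊ ≤ K ^ 2 := by
    rw [Nat.ceil_le]
    push_cast
    rw [sq]
    gcongr
  refine (Nat.div_le_self _ _).trans ?_
  omega

/-- Averaged over the phase, sending at least `n` hash bits takes `n + 2 √n + O(1)` bits: there are
about `√n` stages, each with one bit of Bob, and the surplus of Alice's bits, which varies between
`0` and the length `2 √n` of a block, is `√n` on average. -/
theorem sum_sched_stageFor_le {K : ℕ} (hK : 0 < K) {n : ℝ} (hn : 0 ≤ n) (hnK : n ≤ (K : ℝ) ^ 2) :
    ∑ θ ∈ Finset.range K, ((sched K θ (stageFor K n θ) : ℝ) + stageFor K n θ) ≤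
      K * (n + 2 * √n + 8) := by
  have hK' : (0 : ℝ) < K := Nat.cast_pos.2 hK
  have hK1 : (1 : ℝ) ≤ K := Nat.one_le_cast.2 hK
  set c := ⌈K * √n⌉₊
  set σ : ℝ := c / K with hσ
  have hσ0 : 0 ≤ σ := by positivity
  rw [sum_range_eq_sum_Ico_mod K c]
  have hterm : ∀ i ∈ Finset.Ico c (c + K),
      ((sched K (i % K) (stageFor K n (i % K)) : ℝ) + stageFor K n (i % K)) ≤
        ((i : ℝ) / K) ^ 2 + 1 + i / K := by
    intro i hi
    rw [Finset.mem_Ico] at hi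
    have hst : stageFor K n (i % K) = i / K := stageOf_mod hK hi.1 hi.2
    rw [hst]
    refine add_le_add ?_ Nat.cast_div_le
    unfold sched
    rw [mul_comm, Nat.div_add_mod]
    exact (Nat.ceil_lt_add_one (by positivity)).le
  refine (Finset.sum_le_sum hterm).trans ?_
  rw [Finset.sum_Ico_eq_sum_range, Nat.add_sub_cancel_left]
  have hterm2 : ∀ e ∈ Finset.range K, (((c + e : ℕ) : ℝ) / K) ^ 2 + 1 + ((c + e : ℕ) : ℝ) / K ≤
      (σ ^ 2 + σ + 2) + (e : ℝ) * ((2 * σ + 1) / K) := by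
    intro e he
    have he1 : (e : ℝ) / K ≤ 1 := by
      rw [div_le_one hK']
      exact_mod_cast (Finset.mem_range.1 he).le
    have he0 : (0 : ℝ) ≤ (e : ℝ) / K := by positivity
    have : ((c + e : ℕ) : ℝ) / K = σ + e / K := by push_cast; rw [add_div]
    rw [this]
    have h3 : (e : ℝ) * ((2 * σ + 1) / K) = (e / K) * (2 * σ + 1) := by ring
    rw [h3]
    nlinarith
  refine (Finset.sum_le_sum hterm2).trans ?_
  rw [Finset.sum_add_distrib, ← Finset.sum_mul, Finset.sum_const, Finset.card_range, nsmul_eq_mul]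
  have hgauss : ∑ e ∈ Finset.range K, (e : ℝ) ≤ K * (K / 2) := by
    have h := Finset.sum_range_id_mul_two K
    have h' : (∑ e ∈ Finset.range K, (e : ℝ)) * 2 = K * ((K - 1 : ℕ) : ℝ) := by
      have := congrArg (Nat.cast : ℕ → ℝ) h
      rwa [Nat.cast_mul, Nat.cast_mul, Nat.cast_sum, Nat.cast_two] at this
    have h'' : ((K - 1 : ℕ) : ℝ) ≤ K := Nat.cast_le.2 (Nat.sub_le K 1)
    nlinarith
  have h1 : (∑ e ∈ Finset.range K, (e : ℝ)) * ((2 * σ + 1) / K) ≤ K * (σ + 1 / 2) := by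
    refine (mul_le_mul_of_nonneg_right hgauss (by positivity)).trans_eq ?_
    field_simp
  have hs0 := Real.sqrt_nonneg n
  have hsK : √n ≤ K := Real.sqrt_le_left (Nat.cast_nonneg K) |>.2 hnK
  have hσ1 : σ ≤ √n + 1 / K := by
    rw [hσ, div_le_iff₀ hK', add_mul, one_div_mul_cancel hK'.ne', mul_comm]
    exact (Nat.ceil_lt_add_one (by positivity)).le
  have hinv : 1 / (K : ℝ) ≤ 1 := by rw [div_le_one hK']; exact hK1
  have hinv0 : 0 ≤ 1 / (K : ℝ) := by positivity
  have hsq : σ ^ 2 ≤ n + 3 := by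
    have h2 : √n * (1 / K) ≤ 1 := by
      rw [mul_one_div, div_le_one hK']; exact hsK
    calc σ ^ 2 ≤ (√n + 1 / K) ^ 2 := by gcongr
      _ = √n ^ 2 + 2 * (√n * (1 / K)) + (1 / K) * (1 / K) := by ring
      _ ≤ n + 2 * 1 + 1 * 1 := by rw [Real.sq_sqrt hn]; gcongr
      _ = n + 3 := by ring
  nlinarith

/-- The number of hash bits that are sufficient at log-likelihood ratio `l`. -/
def need (l : ℝ) : ℝ := l + Real.logb 2 (l + 4) + 2

theorem two_le_logb {l : ℝ} (hl : 0 ≤ l) : 2 ≤ Real.logb 2 (l + 4) := by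
  rw [Real.le_logb_iff_rpow_le one_lt_two (by linarith)]
  norm_num
  exact hl

theorem need_nonneg {l : ℝ} (hl : 0 ≤ l) : 0 ≤ need l := by
  have := two_le_logb hl
  unfold need
  linarith

/-- The logarithmic term in `need` pays for the factor `1 / (j + 1) ^ 2` that makes the collision
probabilities of the stages summable. -/
theorem rpow_le_of_need_le {l : ℝ} (hl : 0 ≤ l) {a j : ℕ} (hj : (j : ℝ) ^ 2 ≤ a)
    (ha : need l ≤ a) : (2 : ℝ) ^ l ≤ 2 ^ a / ((j : ℝ) + 1) ^ 2 := by
  rw [le_div_iff₀ (by positivity)]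
  have hlog := two_le_logb hl
  set d : ℝ := a - l with hd
  have hd4 : Real.logb 2 (l + 4) + 2 ≤ d := by rw [hd]; unfold need at ha; linarith
  have h1 : 4 * (l + 4) ≤ (2 : ℝ) ^ d := by
    calc 4 * (l + 4) = (2 : ℝ) ^ (Real.logb 2 (l + 4) + 2) := by
          rw [Real.rpow_add two_pos, Real.rpow_logb two_pos (by norm_num) (by linarith)]
          norm_num
          ring
      _ ≤ (2 : ℝ) ^ d := Real.rpow_le_rpow_of_exponent_le one_le_two hd4
  have h2 : 8 * d - 16 ≤ (2 : ℝ) ^ d := by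
    have h3 : (2 : ℝ) ^ d = 16 * (2 : ℝ) ^ (d - 4) := by
      rw [Real.rpow_sub two_pos d 4]
      norm_num
      ring
    have h4 : 1 + (d - 4) * (1 / 2) ≤ (2 : ℝ) ^ (d - 4) := by
      rw [Real.rpow_def_of_pos two_pos]
      refine le_trans ?_ (Real.add_one_le_exp _)
      have := Real.log_two_gt_d9
      nlinarith
    linarith
  have h5 : ((j : ℝ) + 1) ^ 2 ≤ 2 * (a + 1) := by nlinarith [sq_nonneg ((j : ℝ) - 1)]
  have h6 : (2 : ℝ) ^ a = 2 ^ l * 2 ^ d := by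
    rw [← Real.rpow_add two_pos, hd, add_sub_cancel, Real.rpow_natCast]
  rw [h6]
  gcongr
  have : (a : ℝ) = l + d := by rw [hd]; ring
  linarith

theorem sum_inv_sq_le_two (J : ℕ) : ∑ j ∈ Finset.range J, 1 / ((j : ℝ) + 1) ^ 2 ≤ 2 := by
  suffices h : ∑ j ∈ Finset.range J, 1 / ((j : ℝ) + 1) ^ 2 ≤ 2 - 1 / (J : ℝ) by
    have : 0 ≤ 1 / (J : ℝ) := by positivity
    linarith
  induction J with
  | zero => simp
  | succ J ih =>
    rw [Finset.sum_range_succ]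
    rcases J.eq_zero_or_pos with rfl | hJ
    · norm_num
    · have hJ' : (0 : ℝ) < J := Nat.cast_pos.2 hJ
      have h : 1 / ((J : ℝ) + 1) ^ 2 ≤ 1 / J - 1 / ((J : ℝ) + 1) := by
        rw [div_sub_div _ _ hJ'.ne' (by positivity), div_le_div_iff₀ (by positivity)
          (by positivity)]
        nlinarith
      push_cast
      linarith

/-! ### Compressing a single message -/

theorem prob_lev_le {W V : Type*} [Fintype W] [Fintype V] {p : stdSimplex ℝ W} {val : W → V}
    {lev : W → ℝ} {F : Finset ℝ}
    (h : ∀ c ∈ F, ∀ v, prob p {w | val w = v ∧ lev w ≤ c} = c / Fintype.card V)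
    (c : V → ℝ) (hc : ∀ v, c v ∈ F) (U : Set V) :
    prob p ({w | lev w ≤ c (val w)} ∩ {w | val w ∈ U}) =
      (∑ v, if v ∈ U then c v else 0) / Fintype.card V := by
  have h1 := prob_biUnion_eq p (Finset.univ.filter (· ∈ U))
    (fun v => {w | val w = v ∧ lev w ≤ c v}) fun w v _ v' _ hv hv' => hv.1.symm.trans hv'.1
  rw [Finset.sum_congr rfl fun v _ => h (c v) (hc v) v, ← Finset.sum_div,
    Finset.sum_filter] at h1
  rw [← h1]
  congr 1
  ext w
  simp only [Set.mem_inter_iff, Set.mem_ofPred_eq, Finset.mem_filter, Finset.mem_univ, true_and]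
  constructor
  · rintro ⟨h2, h3⟩
    exact ⟨val w, h3, rfl, h2⟩
  · rintro ⟨v, hv, rfl, h2⟩
    exact ⟨h2, hv⟩

theorem prob_piDist_eval {ι W : Type*} [Fintype ι] [DecidableEq ι] [Fintype W]
    (p : stdSimplex ℝ W) (i : ι) (L : Set W) :
    prob (piDist fun _ : ι => p) {ω | ω i ∈ L} = prob p L := by
  have hset : {ω : ι → W | ω i ∈ L} = {ω | ∀ j, ω j ∈ if j = i then L else Set.univ} := by
    ext ω
    constructor
    · intro h j
      split_ifs with hj
      · exact hj ▸ h
      · trivial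
    · intro h
      simpa using h i
  have hprob : ∀ j, prob p (if j = i then L else Set.univ) = if j = i then prob p L else 1 := by
    intro j
    split_ifs
    exacts [rfl, prob_univ p]
  rw [hset, prob_piDist, Finset.prod_congr rfl fun j _ => hprob j,
    Finset.prod_ite_eq_of_mem' _ _ _ (Finset.mem_univ i)]

/-- The event that some trial other than the first one in `A` is on the list `L j` of a stage
`j < J` and has the same first `b j` hash bits. -/
def Collision {W : Type*} {N B : ℕ} (A : Set W) (L : ℕ → Set W) (b : ℕ → ℕ) (J : ℕ) :
    Set ((Fin N → W) × (Fin B → Fin N → Bool)) :=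
  {c | ∃ e ∈ Finset.range J ×ˢ (Finset.univ : Finset (Fin N)), c.1 e.2 ∈ L e.1 ∧
    ∃ i, IsFirstIn A c.1 i ∧ e.2 ≠ i ∧ ∀ k < b e.1, hashBit c.2 e.2 k = hashBit c.2 i k}

theorem prob_collision_le {W : Type*} [Fintype W] {N B : ℕ} (p : stdSimplex ℝ W) (A : Set W)
    (L : ℕ → Set W) (b : ℕ → ℕ) (J : ℕ) (hb : ∀ j < J, b j ≤ B) :
    prob (prodDist (piDist fun _ : Fin N => p) (piDist fun _ : Fin B => unifDist (Fin N → Bool)))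
      (Collision A L b J) ≤ ∑ j ∈ Finset.range J, N * prob p (L j) * (1 / 2) ^ b j := by
  refine (prob_biUnion_le _ _ _).trans ?_
  rw [Finset.sum_product]
  refine Finset.sum_le_sum fun j hj => ?_
  have hj := hb j (Finset.mem_range.1 hj)
  have hi' : ∀ i' : Fin N, prob (prodDist (piDist fun _ : Fin N => p)
      (piDist fun _ : Fin B => unifDist (Fin N → Bool)))
      {c | c.1 i' ∈ L j ∧
        ∃ i, IsFirstIn A c.1 i ∧ i' ≠ i ∧ ∀ k < b j, hashBit c.2 i' k = hashBit c.2 i k} ≤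
      prob p (L j) * (1 / 2) ^ b j := by
    intro i'
    rw [prob_prodDist, ← prob_piDist_eval p i' (L j), prob, Finset.sum_mul]
    refine Finset.sum_le_sum fun ω _ => ?_
    by_cases hω : ω i' ∈ L j ∧ ∃ i, IsFirstIn A ω i ∧ i' ≠ i
    · obtain ⟨h1, i, h2, h3⟩ := hω
      simp only [Set.mem_ofPred_eq, h1, if_true, true_and]
      refine mul_le_mul_of_nonneg_left ?_ ((piDist fun _ : Fin N => p).2.1 ω)
      rw [← prob_hash_agree hj h3]
      refine prob_mono _ ?_
      rintro h ⟨i₁, h4, -, h5⟩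
      rw [h4.unique h2] at h5
      exact h5
    · have hempty : {h | (ω, h) ∈ {c : (Fin N → W) × (Fin B → Fin N → Bool) | c.1 i' ∈ L j ∧
          ∃ i, IsFirstIn A c.1 i ∧ i' ≠ i ∧
            ∀ k < b j, hashBit c.2 i' k = hashBit c.2 i k}} = ∅ := by
        refine Set.eq_empty_of_forall_notMem ?_
        rintro h ⟨h1, i, h2, h3, -⟩
        exact hω ⟨h1, i, h2, h3⟩
      rw [hempty]
      have : 0 ≤ if ω ∈ {ω : Fin N → W | ω i' ∈ L j} then (piDist fun _ : Fin N => p) ω else 0 := by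
        split_ifs
        exacts [(piDist fun _ : Fin N => p).2.1 ω, le_rfl]
      simp only [prob, Set.mem_empty_iff_false, if_false, Finset.sum_const_zero, mul_zero]
      positivity
  refine (Finset.sum_le_sum fun i' _ => hi' i').trans_eq ?_
  rw [Finset.sum_const, Finset.card_univ, Fintype.card_fin, nsmul_eq_mul, mul_assoc]

theorem prefixBits_eq_iff {f g : ℕ → Bool} {n : ℕ} :
    prefixBits f n = prefixBits g n ↔ ∀ k < n, f k = g k := by
  simp [prefixBits, List.map_inj_left]

/-- The trial that Alice selects: the first one in `A`. -/
def selectFirst {W : Type*} {N : ℕ} (A : Set W) (ω : Fin N → W) : Option (Fin N) :=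
  if h : ∃ i, IsFirstIn A ω i then some h.choose else none

theorem selectFirst_eq_some {W : Type*} {N : ℕ} {A : Set W} {ω : Fin N → W} {i : Fin N}
    (h : IsFirstIn A ω i) : selectFirst A ω = some i := by
  have hex : ∃ i, IsFirstIn A ω i := ⟨i, h⟩
  rw [selectFirst, dif_pos hex, hex.choose_spec.unique h]

theorem selectFirst_eq_none {W : Type*} {N : ℕ} {A : Set W} {ω : Fin N → W}
    (h : ¬ ∃ i, IsFirstIn A ω i) : selectFirst A ω = none := dif_neg h

/-- Bob's guess: some trial from the list `L` with the hash bits `l`. -/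
def guessTrial {W : Type*} {N B : ℕ} (L : Set W) (ω : Fin N → W) (h : Fin B → Fin N → Bool)
    (l : List Bool) : Option (Fin N) :=
  if H : ∃ i, ω i ∈ L ∧ prefixBits (hashBit h i) l.length = l then some H.choose else none

theorem guessTrial_isSome {W : Type*} {N B : ℕ} {L : Set W} {ω : Fin N → W}
    {h : Fin B → Fin N → Bool} {i : Fin N} {n : ℕ} (hi : ω i ∈ L) :
    (guessTrial L ω h (prefixBits (hashBit h i) n)).isSome := by
  have : ∃ i', ω i' ∈ L ∧ prefixBits (hashBit h i') (prefixBits (hashBit h i) n).length =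
      prefixBits (hashBit h i) n := ⟨i, hi, by rw [length_prefixBits]⟩
  rw [guessTrial, dif_pos this]
  rfl

theorem guessTrial_spec {W : Type*} {N B : ℕ} {L : Set W} {ω : Fin N → W}
    {h : Fin B → Fin N → Bool} {i i' : Fin N} {n : ℕ}
    (hg : guessTrial L ω h (prefixBits (hashBit h i) n) = some i') :
    ω i' ∈ L ∧ ∀ k < n, hashBit h i' k = hashBit h i k := by
  unfold guessTrial at hg
  split_ifs at hg with H
  have := H.choose_spec
  rw [Option.some.inj hg, length_prefixBits, prefixBits_eq_iff] at this
  exact this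

section Kernel

variable {X Y O : Type*} {C V : Type} [Fintype X] [Fintype Y] [Fintype C] [Fintype V]

/-- Alice's message `v ∼ P x r` is made known to Bob, who expects `Q y r`: with `N` trials, the
hash lengths `b` and the list sizes `t`, the error is at most the probability that no trial is
accepted plus the expected number of collisions, and the length on message `v` is determined by
any stage `j` with `P x r v ≤ t j * Q y r v`. -/
theorem exists_protocol_of_stages [Nonempty V] (ρ : stdSimplex ℝ C) (P : X → C → V → ℝ)
    (hP0 : ∀ x r v, 0 ≤ P x r v) (hP1 : ∀ x r, ∑ v, P x r v = 1) (Q : Y → C → V → ℝ)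
    (hQ0 : ∀ y r v, 0 ≤ Q y r v) (hQ1 : ∀ y r, ∑ v, Q y r v ≤ 1) (out : V → O) (o : O)
    (N J : ℕ) (b : ℕ → ℕ) (hb : Monotone b) (t : ℕ → ℝ) (ht : ∀ j, 0 ≤ t j)
    (st : X → Y → C → V → ℕ) (hst : ∀ x y r v, st x y r v < J)
    (hPQ : ∀ x y r v, P x r v ≤ t (st x y r v) * Q y r v) :
    ∃ τ : RandomizedProtocol.{_, _, 0, _} X Y O, τ.IsPublicCoin ∧
      (∀ x y, expect τ.coinDist (fun c => ((τ.transcript x y c).length : ℝ)) ≤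
        ∑ r, ρ r * ∑ v, P x r v * ((b (st x y r v) : ℝ) + st x y r v + 2)) ∧
      ∀ x y (U : Set O), (∑ r, ρ r * ∑ v, if out v ∈ U then P x r v else 0) -
          ((1 - 1 / (Fintype.card V : ℝ)) ^ N +
            ∑ j ∈ Finset.range J, N / Fintype.card V * t j * (1 / 2) ^ b j) ≤
        prob τ.coinDist (τ.output x y ⁻¹' U) := by
  have hd : (0 : ℝ) < Fintype.card V := Nat.cast_pos.2 Fintype.card_pos
  -- The finitely many levels that the parties compare with.
  let F : Finset ℝ :=
    (Finset.univ.image fun a : X × C × V => P a.1 a.2.1 a.2.2) ∪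
      (Finset.univ.image fun a : Fin J × Y × C × V => min 1 (t a.1 * Q a.2.1 a.2.2.1 a.2.2.2))
  have hP_le : ∀ x r v, P x r v ≤ 1 := fun x r v => by
    rw [← hP1 x r]
    exact Finset.single_le_sum (fun v _ => hP0 x r v) (Finset.mem_univ v)
  have hF : ∀ c ∈ F, 0 ≤ c ∧ c ≤ 1 := by
    intro c hc
    rcases Finset.mem_union.1 hc with hc | hc <;> obtain ⟨a, -, rfl⟩ := Finset.mem_image.1 hc
    · exact ⟨hP0 _ _ _, hP_le _ _ _⟩
    · exact ⟨le_min zero_le_one (mul_nonneg (ht _) (hQ0 _ _ _)), min_le_left _ _⟩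
  obtain ⟨W, hW, p, val, lev, hlev⟩ :=
    exists_uniform_levels V F (fun c hc => (hF c hc).1) fun c hc => (hF c hc).2
  have hFP : ∀ x r v, P x r v ∈ F := fun x r v =>
    Finset.mem_union_left _ (Finset.mem_image.2 ⟨(x, r, v), Finset.mem_univ _, rfl⟩)
  have hFQ : ∀ j < J, ∀ y r v, min 1 (t j * Q y r v) ∈ F := fun j hj y r v =>
    Finset.mem_union_right _ (Finset.mem_image.2 ⟨(⟨j, hj⟩, y, r, v), Finset.mem_univ _, rfl⟩)
  -- Alice accepts the trials in `A x r`; Bob's list in stage `j` consists of those in `L y r j`.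
  let A : X → C → Set W := fun x r => {w | lev w ≤ P x r (val w)}
  let L : Y → C → ℕ → Set W := fun y r j => {w | lev w ≤ min 1 (t j * Q y r (val w))}
  have hAU : ∀ x r (U : Set V), prob p (A x r ∩ {w | val w ∈ U}) =
      (∑ v, if v ∈ U then P x r v else 0) / Fintype.card V := fun x r U =>
    prob_lev_le hlev (P x r) (hFP x r) U
  have hA : ∀ x r, prob p (A x r) = 1 / Fintype.card V := by
    intro x r
    have := hAU x r Set.univ
    simpa [hP1 x r] using this
  have hL : ∀ j < J, ∀ y r, prob p (L y r j) ≤ t j / Fintype.card V := by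
    intro j hj y r
    have := prob_lev_le hlev (fun v => min 1 (t j * Q y r v)) (hFQ j hj y r) Set.univ
    simp only [Set.mem_univ, Set.ofPred_true, Set.inter_univ, if_true] at this
    refine this.trans_le (div_le_div_of_nonneg_right ?_ hd.le)
    calc ∑ v, min 1 (t j * Q y r v) ≤ ∑ v, t j * Q y r v :=
          Finset.sum_le_sum fun v _ => min_le_right _ _
      _ = t j * ∑ v, Q y r v := by rw [Finset.mul_sum]
      _ ≤ t j * 1 := mul_le_mul_of_nonneg_left (hQ1 y r) (ht j)
      _ = t j := mul_one _
  let T := Fin N → W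
  let H := Fin (b J) → Fin N → Bool
  let pT : stdSimplex ℝ T := piDist fun _ => p
  let pH : stdSimplex ℝ H := piDist fun _ => unifDist (Fin N → Bool)
  -- The selected message has the distribution `P x r`, up to the probability of no acceptance.
  have hsel : ∀ x r (U : Set V), prob pT {ω | ∃ i, IsFirstIn (A x r) ω i ∧ val (ω i) ∈ U} =
      (∑ v, if v ∈ U then P x r v else 0) * (1 - (1 - 1 / (Fintype.card V : ℝ)) ^ N) := by
    intro x r U
    have h := prob_exists_isFirstIn N p (A x r) {w | val w ∈ U}
    rw [hAU, hA] at h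
    exact mul_left_cancel₀ (one_div_ne_zero hd.ne') (h.trans (by ring))
  let good : X → C × T × H → Bool := fun x c => (selectFirst (A x c.1) c.2.1).isSome
  let α : X → C × T × H → ℕ → Bool := fun x c k =>
    ((selectFirst (A x c.1) c.2.1).map fun i => hashBit c.2.2 i k).getD false
  let D : ℕ → Y → C × T × H → List Bool → Option O := fun j y c l =>
    (guessTrial (L y c.1 j) c.2.1 c.2.2 l).map fun i => out (val (c.2.1 i))
  let τ : RandomizedProtocol.{_, _, 0, _} X Y O :=
    { R := C × T × H
      RA := Unit
      RB := Unit
      fintypeR := inferInstance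
      fintypeRA := inferInstance
      fintypeRB := inferInstance
      distR := prodDist ρ (prodDist pT pH)
      distRA := unifDist Unit
      distRB := unifDist Unit
      tree := ProtocolTree.guessing good α D o b J }
  have hα : ∀ x c i, IsFirstIn (A x c.1) c.2.1 i → α x c = hashBit c.2.2 i := by
    intro x c i hi
    funext k
    simp [α, selectFirst_eq_some hi]
  have hgood : ∀ x c i, IsFirstIn (A x c.1) c.2.1 i → good x c = true := by
    intro x c i hi
    simp [good, selectFirst_eq_some hi]
  have hsome : ∀ x y c i, IsFirstIn (A x c.1) c.2.1 i →
      (D (st x y c.1 (val (c.2.1 i))) y c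
        (prefixBits (α x c) (b (st x y c.1 (val (c.2.1 i)))))).isSome := by
    intro x y c i hi
    rw [hα x c i hi]
    simp only [D, Option.isSome_map]
    exact guessTrial_isSome (hi.1.trans (le_min (hP_le _ _ _) (hPQ _ _ _ _)))
  have hcoin : ∀ f : C × T × H → ℝ, expect τ.coinDist (fun c => f c.1) =
      ∑ r, ρ r * expect (prodDist pT pH) fun c => f (r, c) := by
    intro f
    exact (expect_prodDist_fst _ _ f).trans (expect_prodDist _ _ _)
  refine ⟨τ, ProtocolTree.isPublicCoin_guessing _ _ _ _ _ _, fun x y => ?_, fun x y U => ?_⟩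
  · refine (hcoin fun c => ((τ.tree.transcript x y c () ()).length : ℝ)).trans_le ?_
    refine Finset.sum_le_sum fun r _ => mul_le_mul_of_nonneg_left ?_ (ρ.2.1 r)
    let cost : V → ℝ := fun v => (b (st x y r v) : ℝ) + st x y r v + 1
    have hcost : ∀ v, 0 ≤ cost v := fun v => by positivity
    let E : V → Set T := fun v => {ω | ∃ i, IsFirstIn (A x r) ω i ∧ val (ω i) ∈ ({v} : Set V)}
    have hlen : ∀ c : T × H, ((τ.tree.transcript x y (r, c) () ()).length : ℝ) ≤
        1 + ∑ v, if c.1 ∈ E v then cost v else 0 := by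
      intro c
      have h0 : ∀ v ∈ Finset.univ, 0 ≤ if c.1 ∈ E v then cost v else 0 := fun v _ => by
        split_ifs
        exacts [hcost v, le_rfl]
      by_cases hex : ∃ i, IsFirstIn (A x r) c.1 i
      · obtain ⟨i, hi⟩ := hex
        have h1 := ProtocolTree.length_transcript_guessing_le (o := o) hb
          (hgood x (r, c) i hi) (hst x y r (val (c.1 i))) (hsome x y (r, c) i hi)
        have h2 := Finset.single_le_sum h0 (Finset.mem_univ (val (c.1 i)))
        rw [if_pos ⟨i, hi, rfl⟩] at h2
        refine le_trans ?_ (add_le_add_right h2 1)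
        refine (Nat.cast_le.2 h1).trans_eq ?_
        simp only [cost]
        push_cast
        ring
      · have h1 : ((τ.tree.transcript x y (r, c) () ()).length) = 1 :=
          ProtocolTree.length_transcript_guessing_of_not
            (by simp [good, selectFirst_eq_none hex])
        rw [h1, Nat.cast_one]
        exact le_add_of_nonneg_right (Finset.sum_nonneg h0)
    refine (expect_mono _ hlen).trans ?_
    have hexp : expect (prodDist pT pH) (fun c => 1 + ∑ v, if c.1 ∈ E v then cost v else 0) =
        1 + ∑ v, prob pT (E v) * cost v :=
      (expect_prodDist_fst pT pH _).trans (expect_one_add_sum pT E cost)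
    rw [hexp]
    have hE : ∀ v, prob pT (E v) ≤ P x r v := by
      intro v
      rw [hsel x r {v}]
      simp only [Set.mem_singleton_iff, Finset.sum_ite_eq', Finset.mem_univ, if_true]
      refine mul_le_of_le_one_right (hP0 x r v) (sub_le_self _ (pow_nonneg ?_ _))
      rw [← hA x r]
      exact sub_nonneg.2 (prob_le_one _ _)
    calc 1 + ∑ v, prob pT (E v) * cost v ≤ ∑ v, P x r v + ∑ v, P x r v * cost v := by
          rw [hP1]
          gcongr with v
          exact hE v
      _ = _ := by
          rw [← Finset.sum_add_distrib]
          exact Finset.sum_congr rfl fun v _ => by ring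
  · set err := (1 - 1 / (Fintype.card V : ℝ)) ^ N +
      ∑ j ∈ Finset.range J, N / Fintype.card V * t j * (1 / 2) ^ b j
    have hρ : ∑ r, ρ r * err = err := by
      rw [← Finset.sum_mul]
      exact (congrArg (· * err) ρ.2.2).trans (one_mul _)
    have hout : prob τ.coinDist (τ.output x y ⁻¹' U) =
        ∑ r, ρ r * prob (prodDist pT pH) {c | τ.tree.output x y (r, c) () () ∈ U} := by
      have h := hcoin fun c => if τ.tree.output x y c () () ∈ U then 1 else 0
      simp only [expect, mul_ite, mul_one, mul_zero] at h
      exact h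
    rw [hout, ← hρ, ← Finset.sum_sub_distrib]
    refine Finset.sum_le_sum fun r _ => ?_
    rw [← mul_sub]
    refine mul_le_mul_of_nonneg_left ?_ (ρ.2.1 r)
    set S : Set (T × H) := {c | ∃ i, IsFirstIn (A x r) c.1 i ∧ val (c.1 i) ∈ out ⁻¹' U}
    have hSprob : prob (prodDist pT pH) S = (∑ v, if out v ∈ U then P x r v else 0) *
        (1 - (1 - 1 / (Fintype.card V : ℝ)) ^ N) :=
      (prob_prodDist_fst pT pH _).trans (hsel x r (out ⁻¹' U))
    have hcol : prob (prodDist pT pH) (Collision (A x r) (L y r) b J) ≤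
        ∑ j ∈ Finset.range J, N / Fintype.card V * t j * (1 / 2) ^ b j := by
      refine (prob_collision_le p (A x r) (L y r) b J fun j hj => hb hj.le).trans ?_
      refine Finset.sum_le_sum fun j hj => ?_
      have := hL j (Finset.mem_range.1 hj) y r
      rw [div_mul_eq_mul_div, mul_div_assoc]
      gcongr
    -- Without a collision, Bob's guess in any stage is the selected trial.
    have hsub : S ∩ (Collision (A x r) (L y r) b J)ᶜ ⊆
        {c | τ.tree.output x y (r, c) () () ∈ U} := by
      rintro c ⟨⟨i, hi, hU⟩, hc⟩
      have h : τ.tree.output x y (r, c) () () = out (val (c.1 i)) := by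
        refine ProtocolTree.output_guessing hb (hgood x (r, c) i hi) ?_
          (hst x y r (val (c.1 i))) (hsome x y (r, c) i hi)
        intro j hj w hw
        rw [hα x (r, c) i hi] at hw
        obtain ⟨i', hi', rfl⟩ := Option.map_eq_some_iff.1 hw
        obtain ⟨h1, h2⟩ := guessTrial_spec hi'
        by_cases hne : i' = i
        · rw [hne]
        · exact absurd ⟨(j, i'), Finset.mem_product.2
            ⟨Finset.mem_range.2 hj, Finset.mem_univ _⟩, h1, i, hi, hne, h2⟩ hc
      change τ.tree.output x y (r, c) () () ∈ U
      rw [h]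
      exact hU
    have hfin := (prob_inter_compl (prodDist pT pH) S _).trans (prob_mono _ hsub)
    have hU1 : (∑ v, if out v ∈ U then P x r v else 0) ≤ 1 := by
      rw [← hP1 x r]
      refine Finset.sum_le_sum fun v _ => ?_
      split_ifs
      exacts [le_rfl, hP0 x r v]
    have hpow : 0 ≤ (1 - 1 / (Fintype.card V : ℝ)) ^ N := by
      refine pow_nonneg ?_ _
      rw [← hA x r]
      exact sub_nonneg.2 (prob_le_one _ _)
    have := mul_le_mul_of_nonneg_right hU1 hpow
    linarith

end Kernel

/-- The positive part of the log-likelihood ratio. -/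
def posLogRatio (p q : ℝ) : ℝ := max 0 (Real.logb 2 (p / q))

theorem posLogRatio_nonneg (p q : ℝ) : 0 ≤ posLogRatio p q := le_max_left _ _

theorem le_rpow_posLogRatio_mul {p q : ℝ} (hp : 0 ≤ p) (hq : 0 < q) :
    p ≤ 2 ^ posLogRatio p q * q := by
  rcases hp.eq_or_lt with rfl | hp
  · positivity
  · rw [← div_le_iff₀ hq]
    calc p / q = 2 ^ Real.logb 2 (p / q) :=
          (Real.rpow_logb two_pos (by norm_num) (div_pos hp hq)).symm
      _ ≤ _ := Real.rpow_le_rpow_of_exponent_le one_le_two (le_max_right _ _)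

section Kernel

variable {X Y O : Type*} {C V : Type} [Fintype X] [Fintype Y] [Fintype C] [Fintype V]

/-- The joint distribution of inputs drawn from `μ`, public coins drawn from `ρ` and a message of
Alice drawn from `P x r`. -/
def kernelDist (μ : stdSimplex ℝ (X × Y)) (ρ : stdSimplex ℝ C) (P : X → C → stdSimplex ℝ V) :
    stdSimplex ℝ ((X × Y) × C × V) :=
  ⟨fun a => μ a.1 * (ρ a.2.1 * P a.1.1 a.2.1 a.2.2),
    fun a => mul_nonneg (μ.2.1 _) (mul_nonneg (ρ.2.1 _) ((P _ _).2.1 _)), by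
      have h : ∀ x r, ∑ v, P x r v = 1 := fun x r => (P x r).2.2
      have hρ : ∑ r, ρ r = 1 := ρ.2.2
      have hμ : ∑ a, μ a = 1 := μ.2.2
      rw [Fintype.sum_prod_type, ← hμ]
      refine Finset.sum_congr rfl fun a _ => ?_
      simp only [Fintype.sum_prod_type, ← Finset.mul_sum, h, hρ, mul_one]⟩

theorem expect_kernelDist (μ : stdSimplex ℝ (X × Y)) (ρ : stdSimplex ℝ C)
    (P : X → C → stdSimplex ℝ V) (f : (X × Y) × C × V → ℝ) :
    expect (kernelDist μ ρ P) f =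
      ∑ a, μ a * ∑ r, ρ r * ∑ v, P a.1 r v * f (a, r, v) := by
  rw [expect, Fintype.sum_prod_type]
  refine Finset.sum_congr rfl fun a _ => ?_
  rw [Fintype.sum_prod_type, Finset.mul_sum]
  refine Finset.sum_congr rfl fun r _ => ?_
  rw [Finset.mul_sum, Finset.mul_sum]
  refine Finset.sum_congr rfl fun v _ => ?_
  change μ a * (ρ r * P a.1 r v) * f (a, r, v) = _
  ring

/-- With `N` trials of acceptance probability `1 / d` and `k` surplus hash bits, the error
probability is at most `ε`. -/
theorem exists_trials_surplus {d : ℝ} (hd : 1 ≤ d) {ε : ℝ} (hε : 0 < ε) (hε1 : ε ≤ 1) :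
    ∃ N k : ℕ, (k : ℝ) ≤ 2 * Real.logb 2 (1 / ε) + 4 ∧
      (1 - 1 / d) ^ N + N / d * (1 / 2) ^ k * 2 ≤ ε := by
  have hlog : 0 ≤ Real.logb 2 (1 / ε) :=
    Real.logb_nonneg one_lt_two (by rw [le_div_iff₀ hε]; linarith)
  have hd0 : 0 < d := by linarith
  have h2 : 1 ≤ 2 / ε := by rw [le_div_iff₀ hε]; linarith
  refine ⟨⌈d * Real.log (2 / ε)⌉₊, ⌈2 * Real.logb 2 (1 / ε) + 3⌉₊, ?_, ?_⟩
  · have := (Nat.ceil_lt_add_one (show 0 ≤ 2 * Real.logb 2 (1 / ε) + 3 by positivity)).le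
    linarith
  have hN1 : Real.log (2 / ε) ≤ (⌈d * Real.log (2 / ε)⌉₊ : ℝ) / d := by
    rw [le_div_iff₀ hd0, mul_comm]
    exact Nat.le_ceil _
  have hN2 : (⌈d * Real.log (2 / ε)⌉₊ : ℝ) / d ≤ 2 / ε := by
    have h3 := (Nat.ceil_lt_add_one
      (show 0 ≤ d * Real.log (2 / ε) from mul_nonneg hd0.le (Real.log_nonneg h2))).le
    have h4 := Real.log_le_sub_one_of_pos (show 0 < 2 / ε by positivity)
    rw [div_le_iff₀ hd0]
    nlinarith
  have hpow : (1 - 1 / d) ^ ⌈d * Real.log (2 / ε)⌉₊ ≤ ε / 2 := by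
    have h3 : 1 - 1 / d ≤ Real.exp (-(1 / d)) := by
      have := Real.add_one_le_exp (-(1 / d))
      linarith
    have h4 : 0 ≤ 1 - 1 / d := by
      rw [sub_nonneg, div_le_one hd0]
      exact hd
    calc (1 - 1 / d) ^ ⌈d * Real.log (2 / ε)⌉₊
        ≤ Real.exp (-(1 / d)) ^ ⌈d * Real.log (2 / ε)⌉₊ := pow_le_pow_left₀ h4 h3 _
      _ = Real.exp (-(⌈d * Real.log (2 / ε)⌉₊ / d)) := by
          rw [← Real.exp_nat_mul]
          congr 1
          ring
      _ ≤ Real.exp (-Real.log (2 / ε)) := Real.exp_le_exp.2 (neg_le_neg hN1)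
      _ = ε / 2 := by
          rw [Real.exp_neg, Real.exp_log (by positivity), inv_div]
  have hk : (1 / 2 : ℝ) ^ ⌈2 * Real.logb 2 (1 / ε) + 3⌉₊ ≤ ε ^ 2 / 8 := by
    rw [one_div, inv_pow, inv_le_comm₀ (by positivity) (by positivity), inv_div]
    calc 8 / ε ^ 2 = (2 : ℝ) ^ (2 * Real.logb 2 (1 / ε) + 3) := by
          rw [Real.rpow_add two_pos, mul_comm 2, Real.rpow_mul two_pos.le,
            Real.rpow_logb two_pos (by norm_num) (by positivity)]
          norm_num
          ring
      _ ≤ (2 : ℝ) ^ (⌈2 * Real.logb 2 (1 / ε) + 3⌉₊ : ℝ) :=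
          Real.rpow_le_rpow_of_exponent_le one_le_two (Nat.le_ceil _)
      _ = _ := Real.rpow_natCast _ _
  calc (1 - 1 / d) ^ ⌈d * Real.log (2 / ε)⌉₊ + (⌈d * Real.log (2 / ε)⌉₊ : ℝ) / d *
        (1 / 2) ^ ⌈2 * Real.logb 2 (1 / ε) + 3⌉₊ * 2
      ≤ ε / 2 + 2 / ε * (ε ^ 2 / 8) * 2 := by gcongr
    _ = ε := by
      field_simp
      ring

/-- Alice's message can be communicated by about `n + 2 √n` bits, where `n` is slightly more than
the log-likelihood ratio of the message. The phase of the schedule is the best one for `μ`. -/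
theorem exists_protocol_of_kernel [Nonempty V] (μ : stdSimplex ℝ (X × Y)) (ρ : stdSimplex ℝ C)
    (P : X → C → stdSimplex ℝ V) (Q : Y → C → V → ℝ)
    (hQ0 : ∀ y r v, 0 < Q y r v) (hQ1 : ∀ y r, ∑ v, Q y r v ≤ 1) (out : V → O) (o : O)
    {ε : ℝ} (hε : 0 < ε) (hε1 : ε ≤ 1) :
    ∃ τ : RandomizedProtocol.{_, _, 0, _} X Y O, τ.IsPublicCoin ∧
      τ.expectedLength μ ≤ expect (kernelDist μ ρ P) (fun a =>
        need (posLogRatio (P a.1.1 a.2.1 a.2.2) (Q a.1.2 a.2.1 a.2.2)) +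
          2 * √(need (posLogRatio (P a.1.1 a.2.1 a.2.2) (Q a.1.2 a.2.1 a.2.2)))) +
        (2 * Real.logb 2 (1 / ε) + 14) ∧
      ∀ x y (U : Set O), (∑ r, ρ r * ∑ v, if out v ∈ U then P x r v else 0) - ε ≤
        prob τ.coinDist (τ.output x y ⁻¹' U) := by
  set n : (X × Y) × C × V → ℝ := fun a =>
    need (posLogRatio (P a.1.1 a.2.1 a.2.2) (Q a.1.2 a.2.1 a.2.2))
  have hn0 : ∀ a, 0 ≤ n a := fun a => need_nonneg (posLogRatio_nonneg _ _)
  obtain ⟨K, hK, hnK⟩ : ∃ K : ℕ, 0 < K ∧ ∀ a, n a ≤ (K : ℝ) ^ 2 := by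
    obtain ⟨B, hB⟩ := (Set.finite_range n).bddAbove
    refine ⟨⌈B⌉₊ + 1, Nat.succ_pos _, fun a => ?_⟩
    have h1 : n a ≤ ⌈B⌉₊ := (hB ⟨a, rfl⟩).trans (Nat.le_ceil B)
    have h2 : (0 : ℝ) ≤ ⌈B⌉₊ := Nat.cast_nonneg _
    push_cast
    nlinarith
  obtain ⟨N, k, hk, herr⟩ := exists_trials_surplus
    (show (1 : ℝ) ≤ Fintype.card V from Nat.one_le_cast.2 Fintype.card_pos) hε hε1
  obtain ⟨θ, hθ, hlen⟩ : ∃ θ ∈ Finset.range K,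
      expect (kernelDist μ ρ P) (fun a => (sched K θ (stageFor K (n a) θ) : ℝ) +
        stageFor K (n a) θ) ≤ expect (kernelDist μ ρ P) (fun a => n a + 2 * √(n a) + 8) := by
    refine Finset.exists_le_of_sum_le ⟨0, Finset.mem_range.2 hK⟩ ?_
    rw [Finset.sum_const, Finset.card_range, nsmul_eq_mul]
    simp only [expect]
    rw [Finset.sum_comm, Finset.mul_sum]
    refine Finset.sum_le_sum fun a _ => ?_
    rw [← Finset.mul_sum, mul_left_comm]
    exact mul_le_mul_of_nonneg_left (sum_sched_stageFor_le hK (hn0 a) (hnK a))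
      ((kernelDist μ ρ P).2.1 a)
  have hθ := Finset.mem_range.1 hθ
  obtain ⟨τ, hpub, hτlen, hτerr⟩ := exists_protocol_of_stages ρ (fun x r v => P x r v)
    (fun x r v => (P x r).2.1 v) (fun x r => (P x r).2.2) Q (fun y r v => (hQ0 y r v).le) hQ1 out o
    N (K ^ 2 + K + 1) (fun j => k + sched K θ j)
    (fun i j hij => Nat.add_le_add_left (monotone_sched K θ hij) k)
    (fun j => 2 ^ sched K θ j / ((j : ℝ) + 1) ^ 2) (fun j => by positivity)
    (fun x y r v => stageFor K (n ((x, y), r, v)) θ)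
    (fun x y r v => Nat.lt_succ_of_le (stageFor_le (hnK _) θ))
    (fun x y r v => by
      refine (le_rpow_posLogRatio_mul ((P x r).2.1 v) (hQ0 y r v)).trans ?_
      refine mul_le_mul_of_nonneg_right ?_ (hQ0 y r v).le
      exact rpow_le_of_need_le (posLogRatio_nonneg _ _) (sq_le_sched hK θ _)
        (le_sched_stageFor hK _ hθ))
  refine ⟨τ, hpub, ?_, fun x y U => le_trans (sub_le_sub_left ?_ _) (hτerr x y U)⟩
  · have h1 : τ.expectedLength μ ≤ expect (kernelDist μ ρ P) (fun a =>
        ((sched K θ (stageFor K (n a) θ) : ℝ) + stageFor K (n a) θ) + ((k : ℝ) + 2)) := by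
      rw [expect_kernelDist]
      refine (expect_prodDist _ _ _).trans_le (Finset.sum_le_sum fun a _ => ?_)
      refine mul_le_mul_of_nonneg_left ((hτlen a.1 a.2).trans_eq ?_) (μ.2.1 a)
      refine Finset.sum_congr rfl fun r _ => congrArg (ρ r * ·) ?_
      refine Finset.sum_congr rfl fun v _ => congrArg (P a.1 r v * ·) ?_
      push_cast
      ring
    rw [expect_add_const] at h1
    rw [expect_add_const] at hlen
    linarith
  · refine le_trans (add_le_add_right ?_ _) herr
    have : ∀ j ∈ Finset.range (K ^ 2 + K + 1), (N : ℝ) / Fintype.card V *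
        (2 ^ sched K θ j / ((j : ℝ) + 1) ^ 2) * (1 / 2) ^ (k + sched K θ j) =
        N / Fintype.card V * (1 / 2) ^ k * (1 / ((j : ℝ) + 1) ^ 2) := by
      intro j _
      have h2 : (2 : ℝ) ^ sched K θ j * (1 / 2) ^ sched K θ j = 1 := by
        rw [← mul_pow]
        norm_num
      rw [pow_add]
      linear_combination (N / Fintype.card V * (1 / 2) ^ k * (1 / ((j : ℝ) + 1) ^ 2)) * h2
    rw [Finset.sum_congr rfl this, ← Finset.mul_sum]
    exact mul_le_mul_of_nonneg_left (sum_inv_sq_le_two _) (by positivity)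

end Kernel

/-! ### Information complexity of one-round protocols -/

section Entropy

variable {Ω U V W : Type*} [Fintype Ω] (p : stdSimplex ℝ Ω)

theorem condEntropy_eq_expect (A : Ω → V) (B : Ω → W) :
    condEntropy p A B = expect p fun ω => Real.logb 2
      (prob p (B ⁻¹' {B ω}) / prob p (A ⁻¹' {A ω} ∩ B ⁻¹' {B ω})) := by
  have h1 : ∀ a b, prob p (B ⁻¹' {b}) * (condProb p (A ⁻¹' {a}) (B ⁻¹' {b}) *
      Real.logb 2 (1 / condProb p (A ⁻¹' {a}) (B ⁻¹' {b}))) =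
      ∑ ω, if A ω = a ∧ B ω = b then p ω * Real.logb 2
        (prob p (B ⁻¹' {b}) / prob p (A ⁻¹' {a} ∩ B ⁻¹' {b})) else 0 := by
    intro a b
    have h2 : prob p (B ⁻¹' {b}) * condProb p (A ⁻¹' {a}) (B ⁻¹' {b}) =
        prob p (A ⁻¹' {a} ∩ B ⁻¹' {b}) := by
      rcases (prob_nonneg p (B ⁻¹' {b})).eq_or_lt with h | h
      · have h3 := prob_mono p (Set.inter_subset_right : A ⁻¹' {a} ∩ B ⁻¹' {b} ⊆ B ⁻¹' {b})
        rw [← h] at h3 ⊢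
        rw [zero_mul]
        exact (le_antisymm h3 (prob_nonneg _ _)).symm
      · exact mul_div_cancel₀ _ h.ne'
    rw [← mul_assoc, h2, condProb, one_div_div]
    generalize Real.logb 2 (prob p (B ⁻¹' {b}) / prob p (A ⁻¹' {a} ∩ B ⁻¹' {b})) = z
    rw [prob, Finset.sum_mul]
    refine Finset.sum_congr rfl fun ω _ => ?_
    by_cases h : A ω = a ∧ B ω = b
    · rw [if_pos h, if_pos (by exact h)]
    · rw [if_neg h, if_neg (by exact h), zero_mul]
  simp only [condEntropy, entropyGiven, Finset.mul_sum, h1]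
  rw [Finset.sum_congr rfl fun b _ => Finset.sum_comm, Finset.sum_comm]
  refine Finset.sum_congr rfl fun ω _ => ?_
  rw [Finset.sum_eq_single_of_mem (B ω) (Finset.mem_image_of_mem _ (Finset.mem_univ _)),
    Finset.sum_eq_single_of_mem (A ω) (Finset.mem_image_of_mem _ (Finset.mem_univ _))]
  · rw [if_pos ⟨rfl, rfl⟩]
  · exact fun a _ ha => if_neg fun h => ha h.1.symm
  · exact fun b _ hb => Finset.sum_eq_zero fun a _ => if_neg fun h => hb h.2.symm

theorem condMutualInfo_eq_expect (A : Ω → U) (B : Ω → V) (C : Ω → W) :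
    condMutualInfo p A B C = expect p fun ω =>
      Real.logb 2 (prob p {ω' | C ω' = C ω} / prob p {ω' | A ω' = A ω ∧ C ω' = C ω}) -
      Real.logb 2 (prob p {ω' | B ω' = B ω ∧ C ω' = C ω} /
        prob p {ω' | A ω' = A ω ∧ B ω' = B ω ∧ C ω' = C ω}) := by
  rw [condMutualInfo, condEntropy_eq_expect, condEntropy_eq_expect]
  simp only [expect, ← Finset.sum_sub_distrib, ← mul_sub]
  refine Finset.sum_congr rfl fun ω _ => ?_
  congr 5
  · ext ω'
    simp [Prod.ext_iff]
  · ext ω'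
    simp [Prod.ext_iff]

end Entropy

/-- Transcripts of one-round protocols do not depend on the input and the coins of Bob. -/
theorem ProtocolTree.IsOneRound.transcript_eq {X Y R RA RB O : Type*}
    {t : ProtocolTree X Y R RA RB O} (ht : t.IsOneRound) (x : X) (y y' : Y) (r : R) (ra : RA)
    (rb rb' : RB) : t.transcript x y r ra rb = t.transcript x y' r ra rb' := by
  induction t with
  | leaf φ => rfl
  | alice f child ih => exact congrArg _ (ih _ (ht _))
  | bob g child ih => exact ht.elim

section OneRound

variable {X Y O : Type*} [Fintype X] [Fintype Y] {π : RandomizedProtocol X Y O}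
  (μ : stdSimplex ℝ (X × Y))

theorem prob_jointDist (msg : X → π.R → π.RA → List Bool) (S : Set (X × Y)) (r : π.R)
    (M : Set (List Bool)) :
    prob (π.jointDist μ) {ω | ω.1 ∈ S ∧ ω.2.1 = r ∧ msg ω.1.1 ω.2.1 ω.2.2.1 ∈ M} =
      π.distR r * ∑ a, if a ∈ S then μ a * prob π.distRA {ra | msg a.1 r ra ∈ M} else 0 := by
  refine (prob_prodDist _ _ _).trans ?_
  rw [Finset.mul_sum]
  refine Finset.sum_congr rfl fun a _ => ?_
  split_ifs with ha
  · rw [mul_left_comm]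
    congr 1
    refine (prob_prodDist _ _ _).trans ?_
    rw [Finset.sum_eq_single_of_mem r (Finset.mem_univ r)]
    · congr 1
      refine Eq.trans ?_ (prob_prodDist_fst π.distRA π.distRB {ra | msg a.1 r ra ∈ M})
      congr 1
      ext c
      simp [ha]
    · intro r' _ hr
      have : {c : π.RA × π.RB | (r', c) ∈ {c : π.Coins | (a, c) ∈ {ω : (X × Y) × π.Coins |
          ω.1 ∈ S ∧ ω.2.1 = r ∧ msg ω.1.1 ω.2.1 ω.2.2.1 ∈ M}}} = ∅ :=
        Set.eq_empty_of_forall_notMem fun c hc => hr hc.2.1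
      rw [this]
      simp [prob]
  · have : {c : π.Coins | (a, c) ∈ {ω : (X × Y) × π.Coins |
        ω.1 ∈ S ∧ ω.2.1 = r ∧ msg ω.1.1 ω.2.1 ω.2.2.1 ∈ M}} = ∅ :=
      Set.eq_empty_of_forall_notMem fun c hc => ha hc.1
    rw [this]
    simp [prob]

/-- The distribution that Bob expects, on input `y`, for a message that has the weights `P x` on
input `x`. -/
def bayes {V : Type*} (P : X → V → ℝ) (y : Y) (v : V) : ℝ :=
  (∑ x, μ (x, y) * P x v) / ∑ x, μ (x, y)

theorem infoComplexity_eq (msg : X → π.R → π.RA → List Bool)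
    (hmsg : ∀ x y c, π.transcript x y c = msg x c.1 c.2.1) :
    π.infoComplexity μ = expect (π.jointDist μ) fun ω => Real.logb 2
      (prob π.distRA {ra | msg ω.1.1 ω.2.1 ra = msg ω.1.1 ω.2.1 ω.2.2.1} /
        bayes μ (fun x m => prob π.distRA {ra | msg x ω.2.1 ra = m}) ω.1.2
          (msg ω.1.1 ω.2.1 ω.2.2.1)) := by
  rw [RandomizedProtocol.infoComplexity, condMutualInfo_eq_expect, condMutualInfo_eq_expect,
    ← expect_add]
  refine Finset.sum_congr rfl fun ω _ => ?_
  obtain ⟨⟨x, y⟩, r, ra, rb⟩ := ω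
  rcases ((π.jointDist μ).2.1 ((x, y), r, ra, rb)).eq_or_lt with h0 | h0
  · change 0 = (π.jointDist μ) ((x, y), r, ra, rb) at h0
    rw [← h0, zero_mul, zero_mul]
  congr 1
  -- All factors of the weight of a point of positive weight are positive.
  have hpos : 0 < μ (x, y) * (π.distR r * (π.distRA ra * π.distRB rb)) := h0
  have hμ0 : 0 < μ (x, y) := (μ.2.1 _).lt_of_ne fun h => by
    change 0 = μ (x, y) at h
    rw [← h, zero_mul] at hpos
    exact hpos.false
  have hR0 : 0 < π.distR r := (π.distR.2.1 _).lt_of_ne fun h => by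
    change 0 = π.distR r at h
    rw [← h, zero_mul, mul_zero] at hpos
    exact hpos.false
  have hRA0 : 0 < π.distRA ra := (π.distRA.2.1 _).lt_of_ne fun h => by
    change 0 = π.distRA ra at h
    rw [← h, zero_mul, mul_zero, mul_zero] at hpos
    exact hpos.false
  simp only [hmsg]
  set m := msg x r ra
  set q := prob π.distRA {ra | msg x r ra = m}
  have hq0 : 0 < q := hRA0.trans_le (le_prob_of_mem _ (show msg x r ra = m from rfl))
  -- The marginals of the joint distribution of inputs, public coins and message.
  have hY : prob (π.jointDist μ) {ω' | (ω'.1.2, ω'.2.1) = (y, r)} =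
      π.distR r * ∑ x, μ (x, y) := by
    have h := prob_jointDist μ msg {a | a.2 = y} r Set.univ
    simp only [Set.mem_univ, and_true, Set.ofPred_true, prob_univ, mul_one, Set.mem_ofPred_eq] at h
    simp only [Prod.mk.injEq]
    rw [h, Fintype.sum_prod_type]
    simp
  have hX : prob (π.jointDist μ) {ω' | (ω'.1.1, ω'.2.1) = (x, r)} =
      π.distR r * ∑ y, μ (x, y) := by
    have h := prob_jointDist μ msg {a | a.1 = x} r Set.univ
    simp only [Set.mem_univ, and_true, Set.ofPred_true, prob_univ, mul_one, Set.mem_ofPred_eq] at h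
    simp only [Prod.mk.injEq]
    rw [h, Fintype.sum_prod_type, Finset.sum_eq_single_of_mem x (Finset.mem_univ x)]
    · simp
    · intro x' _ hx
      simp [hx]
  have hXY : prob (π.jointDist μ) {ω' | ω'.1 = (x, y) ∧ ω'.2.1 = r} = π.distR r * μ (x, y) := by
    have h := prob_jointDist μ msg {(x, y)} r Set.univ
    simp only [Set.mem_univ, and_true, Set.ofPred_true, prob_univ, mul_one, Set.mem_singleton_iff,
      Finset.sum_ite_eq', Finset.mem_univ, if_true] at h
    exact h
  have hXYM : prob (π.jointDist μ) {ω' | ω'.1 = (x, y) ∧ ω'.2.1 = r ∧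
      msg ω'.1.1 ω'.2.1 ω'.2.2.1 = m} = π.distR r * (μ (x, y) * q) := by
    have h := prob_jointDist μ msg {(x, y)} r {m}
    simp only [Set.mem_singleton_iff, Finset.sum_ite_eq', Finset.mem_univ, if_true] at h
    exact h
  have hYM : prob (π.jointDist μ) {ω' | msg ω'.1.1 ω'.2.1 ω'.2.2.1 = m ∧
      (ω'.1.2, ω'.2.1) = (y, r)} =
      π.distR r * ∑ x, μ (x, y) * prob π.distRA {ra | msg x r ra = m} := by
    have h := prob_jointDist μ msg {a | a.2 = y} r {m}
    rw [Fintype.sum_prod_type] at h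
    simp only [Set.mem_singleton_iff, Set.mem_ofPred_eq, Finset.sum_ite_eq', Finset.mem_univ,
      if_true] at h
    rw [← h]
    congr 1
    ext ω'
    simp only [Prod.mk.injEq, Set.mem_ofPred_eq]
    tauto
  have hXM : prob (π.jointDist μ) {ω' | msg ω'.1.1 ω'.2.1 ω'.2.2.1 = m ∧
      (ω'.1.1, ω'.2.1) = (x, r)} = π.distR r * ((∑ y, μ (x, y)) * q) := by
    have h := prob_jointDist μ msg {a | a.1 = x} r {m}
    rw [Fintype.sum_prod_type, Finset.sum_eq_single_of_mem x (Finset.mem_univ x)] at h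
    · simp only [Set.mem_singleton_iff, Set.mem_ofPred_eq, if_true, ← Finset.sum_mul] at h
      rw [← h]
      congr 1
      ext ω'
      simp only [Prod.mk.injEq, Set.mem_ofPred_eq]
      tauto
    · intro x' _ hx
      simp [hx]
  have e1 : {ω' : (X × Y) × π.Coins | ω'.1.1 = x ∧ (ω'.1.2, ω'.2.1) = (y, r)} =
      {ω' | ω'.1 = (x, y) ∧ ω'.2.1 = r} := by
    ext ω'; simp only [Prod.ext_iff, Set.mem_ofPred_eq]; tauto
  have e2 : {ω' : (X × Y) × π.Coins | ω'.1.2 = y ∧ (ω'.1.1, ω'.2.1) = (x, r)} =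
      {ω' | ω'.1 = (x, y) ∧ ω'.2.1 = r} := by
    ext ω'; simp only [Prod.ext_iff, Set.mem_ofPred_eq]; tauto
  have e3 : {ω' : (X × Y) × π.Coins | ω'.1.1 = x ∧ msg ω'.1.1 ω'.2.1 ω'.2.2.1 = m ∧
      (ω'.1.2, ω'.2.1) = (y, r)} =
      {ω' | ω'.1 = (x, y) ∧ ω'.2.1 = r ∧ msg ω'.1.1 ω'.2.1 ω'.2.2.1 = m} := by
    ext ω'; simp only [Prod.ext_iff, Set.mem_ofPred_eq]; tauto
  have e4 : {ω' : (X × Y) × π.Coins | ω'.1.2 = y ∧ msg ω'.1.1 ω'.2.1 ω'.2.2.1 = m ∧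
      (ω'.1.1, ω'.2.1) = (x, r)} =
      {ω' | ω'.1 = (x, y) ∧ ω'.2.1 = r ∧ msg ω'.1.1 ω'.2.1 ω'.2.2.1 = m} := by
    ext ω'; simp only [Prod.ext_iff, Set.mem_ofPred_eq]; tauto
  rw [e1, e2, e3, e4, hY, hX, hXY, hXYM, hYM, hXM, bayes]
  have hsY : 0 < ∑ x, μ (x, y) := hμ0.trans_le
    (Finset.single_le_sum (f := fun x => μ (x, y)) (fun x _ => μ.2.1 (x, y)) (Finset.mem_univ x))
  have hsYM : 0 < ∑ x, μ (x, y) * prob π.distRA {ra | msg x r ra = m} :=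
    (mul_pos hμ0 hq0).trans_le (Finset.single_le_sum
      (f := fun x => μ (x, y) * prob π.distRA {ra | msg x r ra = m})
      (fun x _ => mul_nonneg (μ.2.1 (x, y)) (prob_nonneg _ _)) (Finset.mem_univ x))
  generalize ∑ x, μ (x, y) = s at hsY
  generalize ∑ x, μ (x, y) * prob π.distRA {ra | msg x r ra = m} = t at hsYM
  generalize ∑ y, μ (x, y) = s'
  rw [mul_div_mul_left _ _ hR0.ne', mul_div_mul_left _ _ hR0.ne', mul_div_mul_left _ _ hR0.ne',
    mul_div_mul_left _ _ hR0.ne', mul_div_mul_right _ _ hq0.ne', sub_self, add_zero,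
    ← Real.logb_div (div_pos hsY hμ0).ne' (div_pos hsYM (mul_pos hμ0 hq0)).ne']
  congr 1
  field_simp

end OneRound

/-! ### From information complexity to expected length -/

/-- Replacing `q` by the larger `2 * q'` and taking the positive part of the logarithm costs only
constants on average. -/
theorem mul_posLogRatio_le {p q q' : ℝ} (hp : 0 ≤ p) (hq : 0 ≤ q) (hpq : 0 < p → 0 < q)
    (hqq' : q ≤ 2 * q') : p * posLogRatio p q' ≤ p * Real.logb 2 (p / q) + p + q / 2 := by
  rcases hp.eq_or_lt with rfl | hp
  · simp only [zero_mul, zero_add]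
    positivity
  have hq := hpq hp
  have hq' : 0 < q' := by linarith
  have h1 : Real.logb 2 (p / q') ≤ Real.logb 2 (p / q) + 1 := by
    have h2 : Real.logb 2 (2 * (p / q)) = Real.logb 2 (p / q) + 1 := by
      rw [Real.logb_mul two_ne_zero (div_pos hp hq).ne', Real.logb_self_eq_one one_lt_two, add_comm]
    rw [← h2]
    refine Real.logb_le_logb_of_le one_lt_two (div_pos hp hq') ?_
    rw [← mul_div_assoc, div_le_div_iff₀ hq' hq]
    nlinarith
  -- The negative part is bounded by `logb 2 u ≤ u` at `u = q / (2 * p)`.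
  have h2 : -(Real.logb 2 (p / q) + 1) ≤ q / (2 * p) := by
    have h3 : -(Real.logb 2 (p / q) + 1) = Real.logb 2 (q / (2 * p)) := by
      rw [Real.logb_div hp.ne' hq.ne', Real.logb_div hq.ne' (by positivity),
        Real.logb_mul two_ne_zero hp.ne', Real.logb_self_eq_one one_lt_two]
      ring
    rw [h3, Real.logb_le_iff_le_rpow one_lt_two (by positivity)]
    have h4 := one_add_mul_self_le_rpow_one_add (s := 1) (by norm_num)
      (p := max 1 (q / (2 * p))) (le_max_left _ _)
    rcases le_total 1 (q / (2 * p)) with h | h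
    · rw [max_eq_right h] at h4
      norm_num at h4
      linarith
    · exact h.trans (Real.one_le_rpow one_le_two (by positivity))
  have h3 : posLogRatio p q' ≤ Real.logb 2 (p / q) + 1 + q / (2 * p) := by
    refine max_le (by linarith) (h1.trans ?_)
    have : 0 ≤ q / (2 * p) := by positivity
    linarith
  calc p * posLogRatio p q' ≤ p * (Real.logb 2 (p / q) + 1 + q / (2 * p)) := by gcongr
    _ = p * Real.logb 2 (p / q) + p + q / 2 := by field_simp

section Kernel

variable {X Y : Type*} {C V : Type} [Fintype X] [Fintype Y] [Fintype V]
  (μ : stdSimplex ℝ (X × Y)) (P : X → C → stdSimplex ℝ V)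

theorem bayes_nonneg {V : Type*} {P : X → V → ℝ} (hP : ∀ x v, 0 ≤ P x v) (y : Y) (v : V) :
    0 ≤ bayes μ P y v :=
  div_nonneg (Finset.sum_nonneg fun x _ => mul_nonneg (μ.2.1 (x, y)) (hP x v))
    (Finset.sum_nonneg fun x _ => μ.2.1 (x, y))

theorem sum_bayes_le_one (r : C) (y : Y) :
    ∑ v, bayes μ (fun x v => P x r v) y v ≤ 1 := by
  simp only [bayes]
  rw [← Finset.sum_div, Finset.sum_comm]
  have h : ∀ x, ∑ v, μ (x, y) * P x r v = μ (x, y) := fun x => by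
    rw [← Finset.mul_sum]
    exact (congrArg (μ (x, y) * ·) (P x r).2.2).trans (mul_one _)
  rw [Finset.sum_congr rfl fun x _ => h x]
  exact div_self_le_one _

/-- Bob's expectation, averaged with the uniform distribution. It never vanishes, so that all
log-likelihood ratios are finite, even on inputs of probability zero. -/
def smoothBayes (y : Y) (r : C) (v : V) : ℝ :=
  (bayes μ (fun x v => P x r v) y v + (Fintype.card V : ℝ)⁻¹) / 2

theorem smoothBayes_pos [Nonempty V] (y : Y) (r : C) (v : V) : 0 < smoothBayes μ P y r v := by
  have h := bayes_nonneg μ (fun x v => (P x r).2.1 v) y v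
  have hd : (0 : ℝ) < (Fintype.card V : ℝ)⁻¹ := inv_pos.2 (Nat.cast_pos.2 Fintype.card_pos)
  exact half_pos (add_pos_of_nonneg_of_pos h hd)

theorem sum_smoothBayes_le_one [Nonempty V] (y : Y) (r : C) :
    ∑ v, smoothBayes μ P y r v ≤ 1 := by
  have h := sum_bayes_le_one μ P r y
  have hd : ∑ _v : V, (Fintype.card V : ℝ)⁻¹ = 1 := (unifDist V).2.2
  simp only [smoothBayes]
  rw [← Finset.sum_div, Finset.sum_add_distrib, hd]
  linarith

theorem expect_posLogRatio_le [Fintype C] (ρ : stdSimplex ℝ C) [Nonempty V] :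
    expect (kernelDist μ ρ P) (fun a =>
        posLogRatio (P a.1.1 a.2.1 a.2.2) (smoothBayes μ P a.1.2 a.2.1 a.2.2)) ≤
      expect (kernelDist μ ρ P) (fun a => Real.logb 2 (P a.1.1 a.2.1 a.2.2 /
        bayes μ (fun x v => P x a.2.1 v) a.1.2 a.2.2)) + 2 := by
  rw [← expect_add_const, expect_kernelDist, expect_kernelDist]
  refine Finset.sum_le_sum fun a _ => ?_
  rcases (μ.2.1 a).eq_or_lt with h0 | h0
  · change 0 = μ a at h0
    rw [← h0, zero_mul, zero_mul]
  refine mul_le_mul_of_nonneg_left ?_ h0.le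
  refine Finset.sum_le_sum fun r _ => mul_le_mul_of_nonneg_left ?_ (ρ.2.1 r)
  have hb0 := bayes_nonneg μ (fun x v => (P x r).2.1 v) a.2
  have hd : (0 : ℝ) ≤ (Fintype.card V : ℝ)⁻¹ := by positivity
  have hterm : ∀ v ∈ Finset.univ,
      P a.1 r v * posLogRatio (P a.1 r v) (smoothBayes μ P a.2 r v) ≤
        P a.1 r v * Real.logb 2 (P a.1 r v / bayes μ (fun x v => P x r v) a.2 v) + P a.1 r v +
          bayes μ (fun x v => P x r v) a.2 v / 2 := by
    intro v _
    refine mul_posLogRatio_le ((P a.1 r).2.1 v) (hb0 v) (fun hp => ?_) ?_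
    · refine div_pos ?_ ?_
      · exact (mul_pos h0 hp).trans_le (Finset.single_le_sum (f := fun x => μ (x, a.2) * P x r v)
          (fun x _ => mul_nonneg (μ.2.1 (x, a.2)) ((P x r).2.1 v)) (Finset.mem_univ a.1))
      · exact h0.trans_le (Finset.single_le_sum (f := fun x => μ (x, a.2))
          (fun x _ => μ.2.1 (x, a.2)) (Finset.mem_univ a.1))
    · unfold smoothBayes
      linarith
  refine (Finset.sum_le_sum hterm).trans ?_
  have h1 : ∑ v, P a.1 r v = 1 := (P a.1 r).2.2
  have h2 := sum_bayes_le_one μ P r a.2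
  simp only [mul_add, Finset.sum_add_distrib, ← Finset.sum_div, ← Finset.sum_mul, h1]
  linarith

end Kernel

section Jensen

variable {Ω : Type*} [Fintype Ω] (p : stdSimplex ℝ Ω)

theorem expect_sqrt_le {f : Ω → ℝ} (hf : ∀ ω, 0 ≤ f ω) :
    expect p (fun ω => √(f ω)) ≤ √(expect p f) :=
  Real.strictConcaveOn_sqrt.concaveOn.le_map_sum (fun ω _ => p.2.1 ω) p.2.2 fun ω _ => hf ω

theorem expect_logb_le {f : Ω → ℝ} (hf : ∀ ω, 0 < f ω) :
    expect p (fun ω => Real.logb 2 (f ω)) ≤ Real.logb 2 (expect p f) := by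
  have h := strictConcaveOn_log_Ioi.concaveOn.le_map_sum (fun ω _ => p.2.1 ω) p.2.2
    fun ω (_ : ω ∈ Finset.univ) => hf ω
  have hlog := Real.log_pos one_lt_two
  simp only [Real.logb, expect, ← mul_div_assoc, ← Finset.sum_div]
  gcongr
  exact h

theorem expect_need_le {f : Ω → ℝ} (hf : ∀ ω, 0 ≤ f ω) {a : ℝ} (ha : expect p f ≤ a) :
    expect p (fun ω => need (f ω) + 2 * √(need (f ω))) ≤ need a + 2 * √(need a) := by
  have hf0 : 0 ≤ expect p f := Finset.sum_nonneg fun ω _ => mul_nonneg (p.2.1 ω) (hf ω)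
  have h1 : expect p (fun ω => need (f ω)) ≤ need a := by
    simp only [need]
    rw [expect_add_const, expect_add]
    have h2 := expect_logb_le p fun ω => show 0 < f ω + 4 by linarith [hf ω]
    rw [expect_add_const] at h2
    have h3 : Real.logb 2 (expect p f + 4) ≤ Real.logb 2 (a + 4) :=
      Real.logb_le_logb_of_le one_lt_two (by linarith) (by linarith)
    linarith
  rw [expect_add, expect_const_mul]
  have h2 := (expect_sqrt_le p fun ω => need_nonneg (hf ω)).trans (Real.sqrt_le_sqrt h1)
  linarith

end Jensen

/-- The one-round protocol `π` presented by the distributions `P x r` of Alice's message and the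
expectations `Q y r` of Bob, with public coins and messages from types in the lowest universe. -/
theorem RandomizedProtocol.IsOneRound.exists_kernel {X Y O : Type*} [Fintype X] [Fintype Y]
    {π : RandomizedProtocol X Y O} (hπ : π.IsOneRound) (μ : stdSimplex ℝ (X × Y)) :
    ∃ (C V : Type) (_ : Fintype C) (_ : Fintype V) (_ : Nonempty V) (ρ : stdSimplex ℝ C)
      (P : X → C → stdSimplex ℝ V) (Q : Y → C → V → ℝ) (out : V → List Bool),
      (∀ y r v, 0 < Q y r v) ∧ (∀ y r, ∑ v, Q y r v ≤ 1) ∧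
      expect (kernelDist μ ρ P) (fun a =>
        posLogRatio (P a.1.1 a.2.1 a.2.2) (Q a.1.2 a.2.1 a.2.2)) ≤ π.infoComplexity μ + 2 ∧
      ∀ x y (U : Set (List Bool)), prob π.coinDist (π.transcript x y ⁻¹' U) =
        ∑ r, ρ r * ∑ v, if out v ∈ U then P x r v else 0 := by
  obtain ⟨x₀, y₀⟩ := nonempty_of_dist μ
  obtain ⟨r₀⟩ := nonempty_of_dist π.distR
  obtain ⟨ra₀⟩ := nonempty_of_dist π.distRA
  obtain ⟨rb₀⟩ := nonempty_of_dist π.distRB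
  let msg : X → π.R → π.RA → List Bool := fun x r ra => π.tree.transcript x y₀ r ra rb₀
  have hmsg : ∀ x y c, π.transcript x y c = msg x c.1 c.2.1 := fun x y c =>
    ProtocolTree.IsOneRound.transcript_eq hπ x y y₀ c.1 c.2.1 c.2.2 rb₀
  let S : Finset (List Bool) := Finset.univ.image fun a : X × π.R × π.RA => msg a.1 a.2.1 a.2.2
  let M : X → π.R → π.RA → {l // l ∈ S} := fun x r ra =>
    ⟨msg x r ra, Finset.mem_image.2 ⟨(x, r, ra), Finset.mem_univ _, rfl⟩⟩
  let e := Fintype.equivFin π.R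
  let ρ := equivDist e π.distR
  let P : X → Fin (Fintype.card π.R) → stdSimplex ℝ {l // l ∈ S} := fun x i =>
    ⟨fun v => prob π.distRA (M x (e.symm i) ⁻¹' {v}), fun v => prob_nonneg _ _, by
      have h := expect_comp π.distRA (M x (e.symm i)) fun _ => 1
      rw [expect_const] at h
      simpa using h.symm⟩
  have hP : ∀ x i v, P x i v = prob π.distRA {ra | msg x (e.symm i) ra = v.1} := by
    intro x i v
    change prob π.distRA (M x (e.symm i) ⁻¹' {v}) = _
    congr 1
    ext ra
    exact Subtype.ext_iff
  have : Nonempty {l // l ∈ S} := ⟨M x₀ r₀ ra₀⟩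
  refine ⟨Fin (Fintype.card π.R), {l // l ∈ S}, inferInstance, inferInstance, this, ρ, P,
    smoothBayes μ P, Subtype.val, smoothBayes_pos μ P, sum_smoothBayes_le_one μ P, ?_, ?_⟩
  · refine (expect_posLogRatio_le μ P ρ).trans_eq (congrArg (· + 2) ?_)
    rw [infoComplexity_eq μ msg hmsg, expect_kernelDist]
    refine Eq.trans ?_ (expect_prodDist _ _ _).symm
    refine Finset.sum_congr rfl fun a _ => congrArg (μ a * ·) ?_
    refine Eq.trans ?_ (expect_prodDist _ _ _).symm
    refine Eq.trans ?_ (Equiv.sum_comp e.symm _)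
    refine Finset.sum_congr rfl fun i _ => congrArg (π.distR (e.symm i) * ·) ?_
    refine Eq.trans ?_ (expect_prodDist_fst π.distRA π.distRB fun ra => Real.logb 2
      (prob π.distRA {ra' | msg a.1 (e.symm i) ra' = msg a.1 (e.symm i) ra} /
        bayes μ (fun x m => prob π.distRA {ra' | msg x (e.symm i) ra' = m}) a.2
          (msg a.1 (e.symm i) ra))).symm
    refine Eq.trans ?_ (expect_comp π.distRA (M a.1 (e.symm i)) fun v => Real.logb 2
      (prob π.distRA {ra' | msg a.1 (e.symm i) ra' = v.1} /
        bayes μ (fun x m => prob π.distRA {ra' | msg x (e.symm i) ra' = m}) a.2 v.1)).symm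
    refine Finset.sum_congr rfl fun v _ => ?_
    simp only [bayes, hP]
    congr 1
    rw [← hP]
    rfl
  · intro x y U
    refine (prob_prodDist _ _ _).trans ?_
    refine Eq.trans (Equiv.sum_comp e.symm _).symm ?_
    refine Finset.sum_congr rfl fun i _ => congrArg (π.distR (e.symm i) * ·) ?_
    have h1 : {b : π.RA × π.RB | (e.symm i, b) ∈ π.transcript x y ⁻¹' U} =
        {b | b.1 ∈ {ra | msg x (e.symm i) ra ∈ U}} := by
      ext b
      simp [hmsg]
    rw [h1, prob_prodDist_fst]
    have h2 := expect_comp π.distRA (M x (e.symm i)) fun v => if v.1 ∈ U then 1 else 0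
    simp only [expect, mul_ite, mul_one, mul_zero] at h2
    exact h2

/-- With probability `c` there is the extra value `none`, otherwise the value is drawn from `ρ`. -/
def optionDist {C : Type*} [Fintype C] (c : ℝ) (hc0 : 0 ≤ c) (hc1 : c ≤ 1) (ρ : stdSimplex ℝ C) :
    stdSimplex ℝ (Option C) :=
  ⟨fun r => r.elim c fun r => (1 - c) * ρ r, fun r => by
      cases r
      exacts [hc0, mul_nonneg (sub_nonneg.2 hc1) (ρ.2.1 _)], by
    have h : ∑ r, ρ r = 1 := ρ.2.2
    rw [Fintype.sum_option]
    simp only [Option.elim, ← Finset.mul_sum, h]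
    ring⟩

/-- Compression with skipping: with probability `c` the message of `π` is replaced by a uniform
one, which costs only a constant number of bits. This saves the fraction `c` of the information,
and adds `c` to the error. -/
theorem exists_compression {X Y O : Type*} [Fintype X] [Fintype Y]
    {π : RandomizedProtocol X Y O} (hπ : π.IsOneRound) (μ : stdSimplex ℝ (X × Y))
    {c : ℝ} (hc0 : 0 ≤ c) (hc1 : c ≤ 1) {ε : ℝ} (hε : 0 < ε) (hε1 : ε ≤ 1) :
    -2 ≤ π.infoComplexity μ ∧
    ∃ τ : RandomizedProtocol.{_, _, 0, 0} X Y (List Bool), τ.IsPublicCoin ∧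
      τ.expectedLength μ ≤ need ((1 - c) * π.infoComplexity μ + 2) +
        2 * √(need ((1 - c) * π.infoComplexity μ + 2)) + (2 * Real.logb 2 (1 / ε) + 14) ∧
      ∀ x y, statDist π.coinDist (π.transcript x y) τ.coinDist (τ.output x y) ≤ c + ε := by
  obtain ⟨C, V, _, _, _, ρ, P, Q, out, hQ0, hQ1, hinfo, hprob⟩ := hπ.exists_kernel μ
  have hinfo0 : 0 ≤ expect (kernelDist μ ρ P) (fun a =>
      posLogRatio (P a.1.1 a.2.1 a.2.2) (Q a.1.2 a.2.1 a.2.2)) :=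
    Finset.sum_nonneg fun a _ => mul_nonneg ((kernelDist μ ρ P).2.1 a) (posLogRatio_nonneg _ _)
  refine ⟨by linarith, ?_⟩
  have hd : (0 : ℝ) < (Fintype.card V : ℝ)⁻¹ := inv_pos.2 (Nat.cast_pos.2 Fintype.card_pos)
  let P' : X → Option C → stdSimplex ℝ V := fun x r => r.elim (unifDist V) (P x)
  let Q' : Y → Option C → V → ℝ := fun y r v => r.elim (Fintype.card V : ℝ)⁻¹ fun r => Q y r v
  obtain ⟨τ, hpub, hlen, herr⟩ := exists_protocol_of_kernel μ (optionDist c hc0 hc1 ρ) P' Q'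
    (fun y r v => by cases r; exacts [hd, hQ0 y _ v])
    (fun y r => by cases r; exacts [(unifDist V).2.2.le, hQ1 y _]) out [] hε hε1
  refine ⟨τ, hpub, hlen.trans (add_le_add_left ?_ _), fun x y => statDist_le _ _ _ _ _ fun U => ?_⟩
  · refine expect_need_le _ (fun a => posLogRatio_nonneg _ _) ?_
    have h0 : posLogRatio (Fintype.card V : ℝ)⁻¹ (Fintype.card V : ℝ)⁻¹ = 0 := by
      rw [posLogRatio, div_self hd.ne', Real.logb_one, max_self]
    have h1 : expect (kernelDist μ (optionDist c hc0 hc1 ρ) P') (fun a =>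
        posLogRatio (P' a.1.1 a.2.1 a.2.2) (Q' a.1.2 a.2.1 a.2.2)) =
        (1 - c) * expect (kernelDist μ ρ P) (fun a =>
          posLogRatio (P a.1.1 a.2.1 a.2.2) (Q a.1.2 a.2.1 a.2.2)) := by
      rw [expect_kernelDist, expect_kernelDist, Finset.mul_sum]
      refine Finset.sum_congr rfl fun a _ => ?_
      rw [mul_left_comm, Fintype.sum_option]
      congr 1
      have hnone : ∑ v, P' a.1 none v * posLogRatio (P' a.1 none v) (Q' a.2 none v) = 0 :=
        Finset.sum_eq_zero fun v _ => (congrArg _ h0).trans (mul_zero _)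
      refine (congrArg (· + _) ((congrArg _ hnone).trans (mul_zero _))).trans ?_
      rw [zero_add, Finset.mul_sum]
      exact Finset.sum_congr rfl fun r _ => mul_assoc _ _ _
    rw [h1]
    have h2 := mul_le_mul_of_nonneg_left hinfo (sub_nonneg.2 hc1)
    linarith
  · refine le_trans ?_ (herr x y U)
    rw [← sub_sub]
    refine sub_le_sub_right ?_ ε
    rw [Fintype.sum_option]
    have h1 : ∑ r, optionDist c hc0 hc1 ρ (some r) * ∑ v, (if out v ∈ U then P' x (some r) v else 0)
        = (1 - c) * prob π.coinDist (π.transcript x y ⁻¹' U) := by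
      rw [hprob, Finset.mul_sum]
      exact Finset.sum_congr rfl fun r _ => mul_assoc _ _ _
    have h2 : 0 ≤ optionDist c hc0 hc1 ρ none * ∑ v, if out v ∈ U then P' x none v else 0 := by
      refine mul_nonneg hc0 (Finset.sum_nonneg fun v _ => ?_)
      split_ifs
      exacts [hd.le, le_rfl]
    rw [h1]
    have h3 := mul_le_of_le_one_right hc0 (prob_le_one π.coinDist (π.transcript x y ⁻¹' U))
    linarith

/-- For `ε ≤ 1 / 2`, additive constants are absorbed by the term with `1 / ε`. -/
theorem length_bound_of_le_half {I ε C : ℝ} (hC : 2 ^ 30 ≤ C) (hI : -2 ≤ I) (hε : 0 < ε) (hε2 : ε ≤ 1 / 2) :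
    need (I + 2) + 2 * √(need (I + 2)) + (2 * Real.logb 2 (1 / ε) + 14) ≤
      I + Real.logb 2 (I + C) + 2 * √(I + Real.logb 2 (I + C)) +
        24 * Real.logb 2 (1 / ε) := by
  have hlog : 1 ≤ Real.logb 2 (1 / ε) := by
    rw [Real.le_logb_iff_rpow_le one_lt_two (by positivity), Real.rpow_one, le_div_iff₀ hε]
    linarith
  have h2 : 2 ≤ Real.logb 2 (I + C) := by
    rw [Real.le_logb_iff_rpow_le one_lt_two (by linarith)]
    norm_num
    linarith
  have h1 : need (I + 2) ≤ I + Real.logb 2 (I + C) + 4 := by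
    have : Real.logb 2 (I + 2 + 4) ≤ Real.logb 2 (I + C) :=
      Real.logb_le_logb_of_le one_lt_two (by linarith) (by linarith)
    unfold need
    linarith
  have h3 : √(need (I + 2)) ≤ √(I + Real.logb 2 (I + C)) + 2 := by
    refine (Real.sqrt_le_sqrt h1).trans (Real.sqrt_le_iff.2 ⟨by positivity, ?_⟩)
    have := Real.sq_sqrt (show 0 ≤ I + Real.logb 2 (I + C) by linarith)
    nlinarith [Real.sqrt_nonneg (I + Real.logb 2 (I + C))]
  linarith

/-- Additive constants are absorbed by a fraction of the information if it is large, and by the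
constant in the logarithm if it is small. -/
theorem length_bound_of_skip {I C : ℝ} (hC : 2 ^ 30 ≤ C) (hI : -2 ≤ I) :
    need ((1 - 1 / 4) * I + 2) + 2 * √(need ((1 - 1 / 4) * I + 2)) +
        (2 * Real.logb 2 (1 / (1 / 4)) + 14) ≤
      I + Real.logb 2 (I + C) + 2 * √(I + Real.logb 2 (I + C)) := by
  have h4 : Real.logb 2 (1 / (1 / 4)) = 2 := by
    rw [Real.logb_eq_iff_rpow_eq two_pos (by norm_num) (by norm_num)]
    norm_num
  have h1 : need ((1 - 1 / 4) * I + 2) + 18 ≤ I + Real.logb 2 (I + C) := by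
    have h2 : Real.logb 2 ((1 - 1 / 4) * I + 2 + 4) ≤ Real.logb 2 (I + 7) :=
      Real.logb_le_logb_of_le one_lt_two (by linarith) (by linarith)
    unfold need
    rcases le_total 88 I with h | h
    · have h3 : Real.logb 2 (I + 7) ≤ Real.logb 2 (I + C) :=
        Real.logb_le_logb_of_le one_lt_two (by linarith) (by linarith)
      linarith
    · have h3 : Real.logb 2 (I + 7) + 23 ≤ Real.logb 2 (I + C) := by
        have h23 : Real.logb 2 (2 ^ 23) = 23 := by
          rw [Real.logb_pow, Real.logb_self_eq_one one_lt_two]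
          norm_num
        rw [← h23, ← Real.logb_mul (by linarith) (by norm_num)]
        exact Real.logb_le_logb_of_le one_lt_two (by linarith) (by linarith)
      linarith
  have h2 : √(need ((1 - 1 / 4) * I + 2)) ≤ √(I + Real.logb 2 (I + C)) :=
    Real.sqrt_le_sqrt (by linarith)
  rw [h4]
  linarith

end

theorem mainTheorem3 :
    ∃ C₁ C₂ : ℝ, 1 ≤ C₁ ∧ 0 < C₂ ∧
      ∀ (X Y O : Type*) [Fintype X] [Fintype Y] (π : RandomizedProtocol X Y O)
        (μ : stdSimplex ℝ (X × Y)) (ε : ℝ), π.IsOneRound → 0 < ε → ε ≤ 1 →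
        ∃ τ : RandomizedProtocol.{_, _, 0, 0} X Y (List Bool),
          τ.IsPublicCoin ∧
          τ.expectedLength μ ≤
            π.infoComplexity μ + Real.logb 2 (π.infoComplexity μ + C₁) +
              2 * √(π.infoComplexity μ + Real.logb 2 (π.infoComplexity μ + C₁)) +
              C₂ * Real.logb 2 (1 / ε) ∧
          ∀ (x : X) (y : Y),
            statDist π.coinDist (π.transcript x y) τ.coinDist (τ.output x y) ≤ ε := by
  refine ⟨2 ^ 30, 24, by norm_num, by norm_num, fun X Y O _ _ π μ ε hπ hε hε1 => ?_⟩
  rcases le_total ε (1 / 2) with h | h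
  · obtain ⟨hI, τ, hpub, hlen, herr⟩ := exists_compression hπ μ le_rfl zero_le_one hε hε1
    rw [sub_zero, one_mul] at hlen
    refine ⟨τ, hpub, hlen.trans (length_bound_of_le_half le_rfl hI hε h), fun x y => ?_⟩
    exact (herr x y).trans_eq (zero_add ε)
  · -- For `ε` near `1` the term with `1 / ε` vanishes; skipping makes room for the constants.
    obtain ⟨hI, τ, hpub, hlen, herr⟩ := exists_compression hπ μ (c := 1 / 4) (ε := 1 / 4)
      (by norm_num) (by norm_num) (by norm_num) (by norm_num)
    have hlog : 0 ≤ 24 * Real.logb 2 (1 / ε) := mul_nonneg (by norm_num)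
      (Real.logb_nonneg one_lt_two (by rw [le_div_iff₀ hε]; linarith))
    refine ⟨τ, hpub, ?_, fun x y => (herr x y).trans (by linarith)⟩
    have := length_bound_of_skip le_rfl hI
    linarith
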